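/- Let $X$ and $Y$ be disjoint finite alphabets, put $\overline{X}=X\cup X^{-1}$, $\overline{Y}=Y\cup Y^{-1}$, and let $u\in\overline{X}^*$ and $v\in\overline{Y}^*$ be nonempty reduced words. Put $w\equiv uv^{-1}\in\overline{X\cup Y}^{\,*}$, where $v^{-1}$ is the formal inverse of $v$. (1) Let $G=\mathrm{Gp}\langle X\cup Y\mid uv^{-1}=1\rangle$ and let $P_w$ be the submonoid of $G$ generated by the elements represented by the prefixes of the word $w$. Then the prefix membership problem for this (cyclically pinched) presentation is decidable: there is an algorithm which, given a word $s\in\overline{X\cup Y}^{\,*}$, decides whether the element of $G$ represented by $s$ belongs to $P_w$. (2) Consequently, the inverse monoid $\mathrm{Inv}\langle X\cup Y\mid uv^{-1}=1\rangle$, i.e. the quotient of the free monoid $\overline{X\cup Y}^{\,*}$ by the smallest congruence containing all pairs $(s,ss^{-1}s)$ and $(ss^{-1}tt^{-1},tt^{-1}ss^{-1})$ with $s,t\in\overline{X\cup Y}^{\,*}$ and the pair $(uv^{-1},1)$, has decidable word problem: there is an algorithm which, given two words $s,t\in\overline{X\cup Y}^{\,*}$, decides whether they represent the same element of this monoid.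 -/

import Mathlib

/-- Words over the doubled alphabet `X ∪ X⁻¹`: the letter `(x, true)` is `x`, and `(x, false)` is
`x⁻¹`. -/
abbrev GWord (X : Type*) : Type _ := List (X × Bool)

/-- Apply a map of alphabets to a word, letter by letter (exponents are kept). -/
def GWord.mapAlphabet {X Z : Type*} (f : X → Z) (w : GWord X) : GWord Z :=
  w.map fun p => (f p.1, p.2)

/-- The group `Gp⟨X | w = 1⟩`. -/
abbrev OneRelGroup {X : Type*} (w : GWord X) : Type _ :=
  PresentedGroup ({FreeGroup.mk w} : Set (FreeGroup X))

/-- The element of `Gp⟨X | w = 1⟩` represented by a word `s`. -/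
def OneRelGroup.ofWord {X : Type*} (w s : GWord X) : OneRelGroup w :=
  PresentedGroup.mk _ (FreeGroup.mk s)

/-- The prefix monoid `P_w`: the submonoid of `Gp⟨X | w = 1⟩` generated by the elements that
are represented by the prefixes of the word `w`. -/
def prefixMonoid {X : Type*} (w : GWord X) : Submonoid (OneRelGroup w) :=
  Submonoid.closure {g | ∃ p : GWord X, p <+: w ∧ OneRelGroup.ofWord w p = g}

/-- The presentation `Gp⟨X | w = 1⟩` has decidable prefix membership problem: there is an algorithm
that decides, given a word `s`, whether the element represented by `s` lies in `P_w`. -/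
def DecidablePrefixMembership {X : Type*} [Primcodable X] (w : GWord X) : Prop :=
  ComputablePred fun s : GWord X => OneRelGroup.ofWord w s ∈ prefixMonoid w

/-- The generating pairs of the congruence that defines `Inv⟨X | w = 1⟩`: those of the Vagner
congruence (`FreeGroup.invRev s` is the formal inverse of the word `s`, without any reduction), and the pair `(w, 1)`. -/
inductive InvRel {X : Type*} (w : GWord X) : FreeMonoid (X × Bool) → FreeMonoid (X × Bool) → Prop
  | regular (s : GWord X) :
      InvRel w (FreeMonoid.ofList s) (FreeMonoid.ofList (s ++ FreeGroup.invRev s ++ s))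
  | idem_comm (s t : GWord X) :
      InvRel w (FreeMonoid.ofList (s ++ FreeGroup.invRev s ++ t ++ FreeGroup.invRev t))
        (FreeMonoid.ofList (t ++ FreeGroup.invRev t ++ s ++ FreeGroup.invRev s))
  | relator : InvRel w (FreeMonoid.ofList w) 1

/-- The special one-relator inverse monoid `Inv⟨X | w = 1⟩`, as the quotient of the free monoid on
`X ∪ X⁻¹` by the smallest congruence that contains the Vagner congruence and `(w, 1)`. -/
abbrev OneRelInverseMonoid {X : Type*} (w : GWord X) : Type _ :=
  (conGen (InvRel w)).Quotient

/-- The element of `Inv⟨X | w = 1⟩` represented by a word `s`. -/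
def OneRelInverseMonoid.ofWord {X : Type*} (w s : GWord X) : OneRelInverseMonoid w :=
  (conGen (InvRel w)).mk' (FreeMonoid.ofList s)

/-- `Inv⟨X | w = 1⟩` has decidable word problem: there is an algorithm that decides, given
two words, whether they represent the same element. -/
def DecidableInverseWordProblem {X : Type*} [Primcodable X] (w : GWord X) : Prop :=
  ComputablePred fun p : GWord X × GWord X =>
    OneRelInverseMonoid.ofWord w p.1 = OneRelInverseMonoid.ofWord w p.2

/-- The relator `u v⁻¹` over the disjoint union of the alphabets `X` and `Y`. -/
def pinchedRelator {X Y : Type*} (u : GWord X) (v : GWord Y) : GWord (X ⊕ Y) :=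
  u.mapAlphabet Sum.inl ++ FreeGroup.invRev (v.mapAlphabet Sum.inr)

/-!
Let `G = Gp⟨X ∪ Y | u v⁻¹ = 1⟩`. It is the amalgam of the free groups `F(X)` and `F(Y)` over the
infinite cyclic groups generated by `u` and by `v`, whose common image in `G` is called `t`.

*Prefix membership.* The prefix monoid `P` is generated by the prefixes of `u` and of `v`, that is,
by the images of two finitely generated submonoids `N` of the factors. After the inverse words have
been added in the case where one of them contains the inverse of its side, the two submonoids
contain the same powers of `u` and of `v` (`PinchedPresentation.exists_generators`), and then
membership in `P` can be read off a normal form (`CyclicAmalgam.val_cons_mem_span_iff`): for a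
reduced sequence `g₁, …, gₙ` the set `S` of the exponents `j` with `t ^ j * g₁ ⋯ gₙ ∈ P` is
determined by `g₁`, `N` and the corresponding set for `g₂, …, gₙ`. As `t ∈ P`, the set `S` is upward
closed, so it is empty, a ray, or all of `ℤ`, and has a finite code. In each case the step from the
tail to the sequence is a question about `{k | c ^ k * h ∈ R}`, where `c` is the side, `u` or `v`,
in the factor of `g₁`, and `R` is `N` or `N * ⟨c⟩`.

The sets `R` are rational subsets of free groups. A substitute for rationality that is easy to carry
through products and finitely generated submonoids is `FreeGroup.FinitelySplit`; it gives a finite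
automaton for the reduced words of `R`, as in Benois' theorem, hence decidable membership, and a
pumping lemma (`FreeGroup.FinitelySplit.exists_bound`), by which emptiness and fullness of
`{k | c ^ k * h ∈ R}` are detected by single membership tests. So a claimed code can be verified.

No procedure for computing normal forms is needed. A certificate for a word `s` consists of a
normal form, the codes of all its tails, and conjugates of the relator that prove that the normal
form represents the same element as `s`. Certificates exist for all words and can be recognized, so
an unbounded search finds one (`ComputablePred.of_certificate`). It answers the prefix membership
problem and the word problem of `G` alike (`PinchedPresentation.exists_decision`).

*The inverse monoid.* In `Inv⟨X ∪ Y | u v⁻¹ = 1⟩` prefixes of the relator are right units, right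
units are maximal in the natural order, and free reduction goes up in that order. Hence a word
lies below its normal form in the amalgam, and a word that represents `1` in `G` lies below `1`: the
monoid is E-unitary (`PinchedPresentation.inverse_le_one`). In an E-unitary special one-relator
inverse monoid two words are equal if and only if they are equal in the group and each labels a path
in the Schützenberger graph of the other (`OneRelInverseMonoid.ofWord_eq_iff`). This graph is,
inside the Cayley graph, the path of the word with a copy of the Schützenberger graph of `1` at each
vertex; the latter is the union of the translates of the relator path by the prefix monoid, so that
its edges are decided by prefix membership.
-/

/-! ### Words in one-relator groups -/

namespace OneRelGroup

open FreeGroup (invRev)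

variable {X : Type*} (w : GWord X)

theorem ofWord_append (s t : GWord X) : ofWord w (s ++ t) = ofWord w s * ofWord w t := by
  rw [ofWord, ← FreeGroup.mul_mk, map_mul]
  rfl

theorem ofWord_invRev (s : GWord X) : ofWord w (invRev s) = (ofWord w s)⁻¹ := by
  rw [ofWord, ← FreeGroup.inv_mk, map_inv]
  rfl

theorem ofWord_nil : ofWord w [] = 1 := rfl

theorem ofWord_self : ofWord w w = 1 := PresentedGroup.one_of_mem rfl

end OneRelGroup

/-! ### Finitely split subsets of free groups -/

namespace FreeGroup

variable {α : Type*}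

/-- A set `R` of elements of a free group is *finitely split* if there are finitely many products
`A i * B i` contained in `R` such that every factorization `a ++ b` of the reduced word of an
element of `R` is accounted for by one of them. This takes the place of rationality: the pairs
`(A i, B i)` correspond to the states of an automaton, `A i` being what leads to the state and `B i`
what leads from it to acceptance. -/
def FinitelySplit (R : Set (FreeGroup α)) : Prop :=
  ∃ (n : ℕ) (A B : Fin n → Set (FreeGroup α)),
    (∀ i, ∀ g ∈ A i, ∀ h ∈ B i, g * h ∈ R) ∧
    ∀ a b : List (α × Bool), IsReduced (a ++ b) → mk (a ++ b) ∈ R →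
      ∃ i, mk a ∈ A i ∧ mk b ∈ B i

theorem FinitelySplit.of_finite {ι : Type*} [Finite ι] {R : Set (FreeGroup α)}
    (A B : ι → Set (FreeGroup α)) (h : ∀ i, ∀ g ∈ A i, ∀ h ∈ B i, g * h ∈ R)
    (h' : ∀ a b : List (α × Bool), IsReduced (a ++ b) → mk (a ++ b) ∈ R →
      ∃ i, mk a ∈ A i ∧ mk b ∈ B i) : FinitelySplit R := by
  obtain ⟨n, ⟨e⟩⟩ := Finite.exists_equiv_fin ι
  refine ⟨n, A ∘ e.symm, B ∘ e.symm, fun i => h _, fun a b hab hR => ?_⟩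
  obtain ⟨i, hi⟩ := h' a b hab hR
  exact ⟨e i, by simpa using hi⟩

theorem red_of_mk_eq {x w : List (α × Bool)} (hw : IsReduced w) (h : mk x = mk w) : Red x w := by
  classical
  have := reduce.sound h
  rw [hw.reduce_eq] at this
  exact this ▸ reduce.red

/-- The reduced word of `r * s` is obtained from the concatenation of the words of `r` and `s` by
cancellation, so a factorization of it lifts to a factorization of the concatenation, which cuts
one of the two words. -/
theorem FinitelySplit.mul {R S : Set (FreeGroup α)} (hR : FinitelySplit R)
    (hS : FinitelySplit S) : FinitelySplit {g | ∃ r ∈ R, ∃ s ∈ S, r * s = g} := by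
  classical
  obtain ⟨n, A, B, h1, h2⟩ := hR
  obtain ⟨m, A', B', h1', h2'⟩ := hS
  refine FinitelySplit.of_finite (ι := Fin n ⊕ Fin m)
    (Sum.elim A fun j => {g | ∃ r ∈ R, ∃ s ∈ A' j, r * s = g})
    (Sum.elim (fun i => {g | ∃ r ∈ B i, ∃ s ∈ S, r * s = g}) B') ?_ ?_
  · rintro (i | j) g hg h hh
    · obtain ⟨r, hr, s, hs, rfl⟩ := hh
      exact ⟨g * r, h1 i g hg r hr, s, hs, mul_assoc _ _ _⟩
    · obtain ⟨r, hr, s, hs, rfl⟩ := hg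
      exact ⟨r, hr, s * h, h1' j s hs h hh, (mul_assoc _ _ _).symm⟩
  · rintro a b hab ⟨r, hr, s, hs, hrs⟩
    have hred : Red (r.toWord ++ s.toWord) (a ++ b) :=
      red_of_mk_eq hab (by rw [← mul_mk, mk_toWord, mk_toWord, hrs])
    obtain ⟨x, y, hxy, hx, hy⟩ := Red.to_append_iff.1 hred
    rw [← mk_toWord (x := r)] at hr
    rw [← mk_toWord (x := s)] at hs
    have hrr := isReduced_toWord (x := r)
    have hss := isReduced_toWord (x := s)
    have ha : mk x = mk a := reduce.exact (reduce.eq_of_red hx)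
    have hb : mk y = mk b := reduce.exact (reduce.eq_of_red hy)
    rcases List.append_eq_append_iff.1 hxy with ⟨z, h3, h4⟩ | ⟨z, h3, h4⟩
    · rw [h4] at hs hss
      obtain ⟨j, hj, hj'⟩ := h2' _ _ hss hs
      refine ⟨Sum.inr j, ⟨_, hr, _, hj, ?_⟩, hb ▸ hj'⟩
      rw [← ha, h3, mul_mk]
    · rw [h3] at hr hrr
      obtain ⟨i, hi, hi'⟩ := h2 _ _ hrr hr
      refine ⟨Sum.inl i, ha ▸ hi, ⟨_, hi', _, hs, ?_⟩⟩
      rw [← hb, h4, mul_mk]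

theorem exists_flatten_of_mem_closure {W : Set (List (α × Bool))} {g : FreeGroup α}
    (hg : g ∈ Submonoid.closure (mk '' W)) :
    ∃ l : List (List (α × Bool)), (∀ x ∈ l, x ∈ W) ∧ mk l.flatten = g := by
  induction hg using Submonoid.closure_induction with
  | mem x hx =>
    obtain ⟨w, hw, rfl⟩ := hx
    exact ⟨[w], by simpa using hw, by simp⟩
  | one => exact ⟨[], by simp, rfl⟩
  | mul x y _ _ hx hy =>
    obtain ⟨l, hl, rfl⟩ := hx
    obtain ⟨m, hm, rfl⟩ := hy
    refine ⟨l ++ m, fun x hx => ?_, by simp⟩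
    rcases List.mem_append.1 hx with h | h
    exacts [hl x h, hm x h]

theorem mk_flatten_mem_closure {W : Set (List (α × Bool))} {l : List (List (α × Bool))}
    (hl : ∀ x ∈ l, x ∈ W) : mk l.flatten ∈ Submonoid.closure (mk '' W) := by
  induction l with
  | nil => exact one_mem _
  | cons x l ih =>
    simp only [List.mem_cons, forall_eq_or_imp] at hl
    rw [List.flatten_cons, ← mul_mk]
    exact mul_mem (Submonoid.subset_closure ⟨x, hl.1, rfl⟩) (ih hl.2)

/-- A cut of a concatenation of words falls between two of the words or inside one of them. -/
theorem flatten_eq_append {β : Type*} {l : List (List β)} {x y : List β} (h : l.flatten = x ++ y) :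
    (∃ l₁ l₂, l = l₁ ++ l₂ ∧ x = l₁.flatten ∧ y = l₂.flatten) ∨
    ∃ l₁ p q l₂, l = l₁ ++ (p ++ q) :: l₂ ∧ x = l₁.flatten ++ p ∧ y = q ++ l₂.flatten := by
  induction l generalizing x with
  | nil =>
    left
    simp only [List.flatten_nil, List.nil_eq, List.append_eq_nil_iff] at h
    exact ⟨[], [], by simp [h.1, h.2]⟩
  | cons a l ih =>
    rw [List.flatten_cons] at h
    rcases List.append_eq_append_iff.1 h with ⟨z, h1, h2⟩ | ⟨z, h1, h2⟩
    · rcases ih h2 with ⟨l₁, l₂, rfl, rfl, rfl⟩ | ⟨l₁, p, q, l₂, rfl, rfl, rfl⟩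
      · exact Or.inl ⟨a :: l₁, l₂, by simp, by simp [h1], rfl⟩
      · exact Or.inr ⟨a :: l₁, p, q, l₂, by simp, by simp [h1], rfl⟩
    · exact Or.inr ⟨[], x, z, l, by simp [h1], by simp, h2⟩

/-- A finitely generated submonoid is finitely split: a cut of a product of generators falls between
two generators or inside one, which leaves finitely many possibilities for the interrupted
generator. -/
theorem FinitelySplit.closure {W : Set (List (α × Bool))} (hW : W.Finite) :
    FinitelySplit (Submonoid.closure (mk '' W) : Set (FreeGroup α)) := by
  classical
  have := hW.to_subtype
  set N := Submonoid.closure (mk '' W) with hN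
  refine FinitelySplit.of_finite (ι := Option (Σ w : W, Fin (w.1.length + 1)))
    (fun i => i.elim N fun k => {g | ∃ n ∈ N, n * mk (k.1.1.take k.2) = g})
    (fun i => i.elim N fun k => {g | ∃ n ∈ N, mk (k.1.1.drop k.2) * n = g}) ?_ ?_
  · rintro (_ | ⟨w, k⟩) g hg h hh
    · exact mul_mem hg hh
    · obtain ⟨n, hn, rfl⟩ := hg
      obtain ⟨m, hm, rfl⟩ := hh
      have : mk (w.1.take k) * mk (w.1.drop k) = mk w.1 := by
        rw [mul_mk, List.take_append_drop]
      have e : n * mk (w.1.take k) * (mk (w.1.drop k) * m) = n * mk w.1 * m := by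
        rw [← this]; simp only [mul_assoc]
      show _ ∈ N
      rw [e]
      exact mul_mem (mul_mem hn (Submonoid.subset_closure ⟨_, w.2, rfl⟩)) hm
  · intro a b hab h
    obtain ⟨l, hl, hlg⟩ := exists_flatten_of_mem_closure h
    obtain ⟨x, y, hxy, hx, hy⟩ := Red.to_append_iff.1 (red_of_mk_eq hab hlg)
    have ha : mk x = mk a := reduce.exact (reduce.eq_of_red hx)
    have hb : mk y = mk b := reduce.exact (reduce.eq_of_red hy)
    rw [← ha, ← hb]
    rcases flatten_eq_append hxy with ⟨l₁, l₂, rfl, rfl, rfl⟩ | ⟨l₁, p, q, l₂, rfl, rfl, rfl⟩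
    · exact ⟨none, mk_flatten_mem_closure fun x hx => hl x (by simp [hx]),
        mk_flatten_mem_closure fun x hx => hl x (by simp [hx])⟩
    · refine ⟨some ⟨⟨p ++ q, hl _ (by simp)⟩, ⟨p.length, by simp⟩⟩,
        ⟨_, mk_flatten_mem_closure (l := l₁) fun x hx => hl x (by simp [hx]), ?_⟩,
        ⟨_, mk_flatten_mem_closure (l := l₂) fun x hx => hl x (by simp [hx]), ?_⟩⟩
      · simp
      · simp

theorem isReduced_append_iff {a b : List (α × Bool)} : IsReduced (a ++ b) ↔
    IsReduced a ∧ IsReduced b ∧ ∀ x ∈ a.getLast?, ∀ y ∈ b.head?, x.1 = y.1 → x.2 = y.2 := by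
  simp only [IsReduced, List.isChain_append]

/-- Benois' theorem, in the form needed here, through the Myhill–Nerode criterion. -/
theorem FinitelySplit.isRegular [Finite α] {R : Set (FreeGroup α)} (hR : FinitelySplit R) :
    Language.IsRegular ({w | IsReduced w ∧ mk w ∈ R} : Language (α × Bool)) := by
  classical
  obtain ⟨n, A, B, h1, h2⟩ := hR
  refine Language.IsRegular.of_finite_range_leftQuotient ?_
  -- The left quotient by `a` depends only on the splittings in which `a` can take part, on the
  -- last letter of `a`, and on whether `a` is reduced.
  let F : Set (Fin n) × Option (α × Bool) × Prop → Language (α × Bool) := fun d =>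
    {b | d.2.2 ∧ IsReduced b ∧ (∀ x ∈ d.2.1, ∀ y ∈ b.head?, x.1 = y.1 → x.2 = y.2) ∧
      ∃ i ∈ d.1, mk b ∈ B i}
  refine (Set.finite_range F).subset ?_
  rintro _ ⟨a, rfl⟩
  refine ⟨({i | mk a ∈ A i}, a.getLast?, IsReduced a), ?_⟩
  ext b
  constructor
  · rintro ⟨ha, hb, hab, i, hi, hi'⟩
    refine ⟨isReduced_append_iff.2 ⟨ha, hb, hab⟩, ?_⟩
    rw [← mul_mk]
    exact h1 i _ hi _ hi'
  · rintro ⟨hab, hR⟩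
    obtain ⟨i, hi, hi'⟩ := h2 a b hab hR
    obtain ⟨ha, hb, hab⟩ := isReduced_append_iff.1 hab
    exact ⟨ha, hb, hab, i, hi, hi'⟩

/-- The automaton `D` decides membership in `R` on reduced words. Its behaviour on other words is
not restricted. -/
def IsRecognizedBy (R : Set (FreeGroup α)) {n : ℕ} (D : DFA (α × Bool) (Fin n)) : Prop :=
  ∀ w, IsReduced w → (mk w ∈ R ↔ w ∈ D.accepts)

theorem FinitelySplit.exists_dfa [Finite α] {R : Set (FreeGroup α)} (hR : FinitelySplit R) :
    ∃ (n : ℕ) (D : DFA (α × Bool) (Fin n)), IsRecognizedBy R D := by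
  obtain ⟨σ, _, D, hD⟩ := hR.isRegular
  refine ⟨_, D.reindex (Fintype.equivFin σ), fun w hw => ?_⟩
  rw [DFA.accepts_reindex, hD]
  exact ⟨fun h => ⟨hw, h⟩, fun h => h.2⟩

theorem exists_iterate_periodic {β : Type*} [Finite β] (f : β → β) :
    ∃ N p, 0 < p ∧ ∀ n, N ≤ n → f^[n + p] = f^[n] := by
  obtain ⟨i, j, hij, h⟩ := Finite.exists_ne_map_eq_of_infinite fun n : ℕ => f^[n]
  wlog hlt : i < j generalizing i j
  · exact this j i hij.symm h.symm (by omega)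
  refine ⟨i, j - i, by omega, fun n hn => ?_⟩
  obtain ⟨k, rfl⟩ := Nat.exists_eq_add_of_le hn
  rw [show i + k + (j - i) = k + j by omega, show i + k = k + i by omega, Function.iterate_add,
    Function.iterate_add]
  exact congrArg _ h.symm

theorem evalFrom_flatten_replicate {β σ : Type*} (D : DFA β σ) (w : List β) (n : ℕ) (s : σ) :
    D.evalFrom s (List.replicate n w).flatten = (fun s => D.evalFrom s w)^[n] s := by
  induction n generalizing s with
  | zero => rfl
  | succ n ih =>
    rw [List.replicate_succ, List.flatten_cons, DFA.evalFrom_of_append, ih,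
      Function.iterate_succ_apply]

/-- Multiplying a reduced word `p` by a word `h` cancels at most the last `h.length` letters. -/
theorem exists_isReduced_append_eq {p : List (α × Bool)} (h : List (α × Bool)) (hp : IsReduced p) :
    ∃ p₁ h₂, IsReduced (p₁ ++ h₂) ∧ mk (p ++ h) = mk (p₁ ++ h₂) ∧ p₁ <+: p ∧
      p.length ≤ p₁.length + h.length := by
  induction h generalizing p with
  | nil => exact ⟨p, [], by simpa using hp, rfl, List.prefix_rfl, by simp⟩
  | cons x h ih =>
    by_cases hx : IsReduced (p ++ [x])
    · obtain ⟨p₁, h₂, h1, h2, h3, h4⟩ := ih hx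
      rcases List.prefix_concat_iff.1 h3 with rfl | h3
      · exact ⟨p, x :: h₂, by simpa using h1, by simpa using h2, List.prefix_rfl, by simp⟩
      · exact ⟨p₁, h₂, h1, by simpa using h2, h3, by simp at h4 ⊢; omega⟩
    · rcases List.eq_nil_or_concat p with rfl | ⟨p, y, rfl⟩
      · simp at hx
      · have hxy : y = (x.1, !x.2) := by
          rw [List.concat_eq_append] at hp hx
          rw [isReduced_append_iff] at hx
          simp only [hp, IsReduced.singleton, true_and] at hx
          simp at hx
          ext
          · exact hx.1
          · cases hy : y.2 <;> cases hx' : x.2 <;> simp_all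
        obtain ⟨p₁, h₂, h1, h2, h3, h4⟩ := ih (p := p) (hp.infix ⟨[], [y], by simp⟩)
        refine ⟨p₁, h₂, h1, ?_, h3.trans ⟨[y], by simp⟩, by simp at h4 ⊢; omega⟩
        rw [← h2, hxy]
        have := Quot.sound (Red.Step.not_rev (L₁ := p) (L₂ := h) (x := x.1) (b := x.2))
        simp only [List.concat_eq_append, List.append_assoc, List.singleton_append]
        exact this

/-- A sufficiently high power of a cyclically reduced word `c` absorbs the cancellation caused by
`h`, and further factors `c` on the left cause none. -/
theorem exists_isReduced_append_flatten {c : List (α × Bool)} (hc : IsCyclicallyReduced c)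
    (hc0 : c ≠ []) (h : List (α × Bool)) : ∃ e, IsReduced (c ++ e) ∧
      mk ((List.replicate (h.length + 1) c).flatten ++ h) = mk e := by
  obtain ⟨p₁, h₂, h1, h2, ⟨q, h3⟩, h4⟩ :=
    exists_isReduced_append_eq h (hc.flatten_replicate (h.length + 1)).isReduced
  refine ⟨p₁ ++ h₂, ?_, h2⟩
  have hc1 : 1 ≤ c.length := List.length_pos_iff.2 hc0
  have hp : p₁ ≠ [] := by
    rintro rfl
    simp at h4
    nlinarith
  rw [← List.append_assoc]
  refine IsReduced.append_overlap ?_ h1 hp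
  have := (hc.flatten_replicate (h.length + 1 + 1)).isReduced
  rw [List.replicate_succ, List.flatten_cons, ← h3] at this
  exact this.infix ⟨[], q, by simp⟩

theorem conj_pow_eq {d c : List (α × Bool)} (n : ℕ) :
    mk (d ++ c ++ invRev d) ^ n = mk d * mk c ^ n * (mk d)⁻¹ := by
  rw [← mul_mk, ← mul_mk, ← inv_mk, conj_pow]

/-- The pumping lemma: membership of `z ^ k * h` in `R` is periodic in `k` once `k` exceeds the
length of `h` by a constant. The power of the cyclic core of `z` is read by the automaton as the
iteration of one transformation of its finite set of states. -/
theorem FinitelySplit.exists_pow_periodic [Finite α] {R : Set (FreeGroup α)}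
    (hR : FinitelySplit R) {z : List (α × Bool)} (hz : IsReduced z) (hz0 : z ≠ []) :
    ∃ C p : ℕ, 0 < p ∧ ∀ (h : List (α × Bool)) (k : ℕ), h.length + C ≤ k →
      (mk z ^ (k + p) * mk h ∈ R ↔ mk z ^ k * mk h ∈ R) := by
  classical
  obtain ⟨n, D, hD⟩ := hR.exists_dfa
  set d := reduceCyclically.conjugator z with hd
  set c := reduceCyclically z with hc
  have hzd : d ++ c ++ invRev d = z := reduceCyclically.conj_conjugator_reduceCyclically z
  have hcc : IsCyclicallyReduced c := reduceCyclically.isCyclicallyReduced hz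
  have hc0 : c ≠ [] := by
    intro h0
    rw [h0] at hzd
    rw [← hzd, List.append_nil] at hz
    have := hz.reduce_eq
    rw [← invRev_invRev (L₁ := d), invRev_invRev (L₁ := invRev d),
      reduce_invRev_left_cancel] at this
    rw [← hzd] at hz0
    exact hz0 (by simpa using this.symm)
  obtain ⟨N, p, hp, hN⟩ := exists_iterate_periodic fun s => D.evalFrom s c
  refine ⟨d.length + N + 2, p, hp, fun h k hk => ?_⟩
  obtain ⟨e, he, he'⟩ := exists_isReduced_append_flatten hcc hc0 (invRev d ++ h)
  have key : ∀ j, N ≤ j → 1 ≤ j → (mk z ^ (j + ((invRev d ++ h).length + 1)) * mk h ∈ R ↔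
      D.evalFrom ((fun s => D.evalFrom s c)^[j] (D.evalFrom D.start d)) e ∈ D.accept) := by
    intro j _ hj
    have h1 : mk z ^ (j + ((invRev d ++ h).length + 1)) * mk h =
        mk (d ++ (List.replicate j c).flatten ++ e) := by
      rw [← hzd, conj_pow_eq, pow_add, ← mul_mk, ← mul_mk, ← he', ← mul_mk, ← mul_mk, ← pow_mk,
        ← pow_mk, inv_mk]
      simp only [mul_assoc]
    have h2 : IsReduced (d ++ (List.replicate j c).flatten ++ e) := by
      refine IsReduced.append_flatten_replicate_append hcc ?_ (by omega)
      refine IsReduced.append_overlap ?_ he hc0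
      rw [← hzd] at hz
      exact hz.infix ⟨[], invRev d, by simp⟩
    rw [h1, hD _ h2, DFA.mem_accepts, DFA.eval, DFA.evalFrom_of_append, DFA.evalFrom_of_append,
      evalFrom_flatten_replicate]
  have hl : (invRev d ++ h).length = d.length + h.length := by simp
  rw [hl] at key
  obtain ⟨j, rfl⟩ : ∃ j, k = j + (d.length + h.length + 1) :=
    ⟨k - (d.length + h.length + 1), by omega⟩
  rw [show j + (d.length + h.length + 1) + p = (j + p) + (d.length + h.length + 1) by omega,
    key _ (by omega) (by omega), key _ (by omega) (by omega), hN j (by omega)]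

/-- If `R` is stable under left multiplication by `z`, then the set of exponents `k` with
`z ^ k * h ∈ R` is upward closed. By periodicity, one test at a positive and one at a negative
exponent of size `h.length + C` tell whether it is empty and whether it is all of `ℤ`. -/
theorem FinitelySplit.exists_bound [Finite α] {R : Set (FreeGroup α)}
    (hR : FinitelySplit R) {z : List (α × Bool)} (hz : IsReduced z) (hz0 : z ≠ [])
    (hup : ∀ g ∈ R, mk z * g ∈ R) :
    ∃ C : ℕ, ∀ h : List (α × Bool),
      ((∃ k : ℤ, mk z ^ k * mk h ∈ R) → mk z ^ (h.length + C) * mk h ∈ R) ∧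
      ((mk z)⁻¹ ^ (h.length + C) * mk h ∈ R → ∀ k : ℤ, mk z ^ k * mk h ∈ R) := by
  have hup' : ∀ (g) (i j : ℤ), i ≤ j → mk z ^ i * g ∈ R → mk z ^ j * g ∈ R := by
    intro g i j hij hg
    induction j, hij using Int.leInduction with
    | base => exact hg
    | succ j _ ih =>
      rw [add_comm, zpow_add, zpow_one, mul_assoc]
      exact hup _ ih
  obtain ⟨C, p, hp, hC⟩ := hR.exists_pow_periodic hz hz0
  obtain ⟨C', p', hp', hC'⟩ := hR.exists_pow_periodic (z := invRev z)
    (by classical rw [isReduced_iff_reduce_eq, reduce_invRev, hz.reduce_eq])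
    (by simpa [invRev] using hz0)
  have iter : ∀ (C p : ℕ) (x : FreeGroup α), (∀ (h : List (α × Bool)) (k : ℕ), h.length + C ≤ k →
      (x ^ (k + p) * mk h ∈ R ↔ x ^ k * mk h ∈ R)) →
      ∀ (h : List (α × Bool)) (k n : ℕ), h.length + C ≤ k →
      (x ^ (k + n * p) * mk h ∈ R ↔ x ^ k * mk h ∈ R) := by
    intro C p x H h k n hk
    induction n with
    | zero => simp
    | succ n ih => rw [← ih, ← H _ (k + n * p) (by omega)]; ring_nf
  refine ⟨max C C', fun h => ⟨?_, ?_⟩⟩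
  · rintro ⟨k, hk⟩
    rw [← iter C p _ hC h _ k.natAbs (by omega), ← zpow_natCast]
    refine hup' _ _ _ ?_ hk
    have : k.natAbs ≤ k.natAbs * p := Nat.le_mul_of_pos_right _ hp
    omega
  · intro hk k
    rw [inv_mk, ← iter C' p' _ hC' h _ k.natAbs (by omega), ← inv_mk, inv_pow, ← zpow_natCast,
      ← zpow_neg] at hk
    refine hup' _ _ _ ?_ hk
    have : k.natAbs ≤ k.natAbs * p' := Nat.le_mul_of_pos_right _ hp'
    omega

end FreeGroup

/-! ### Normal forms in amalgams over a cyclic group -/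

/-- A sequence of pairs `(b, g)`, where `g` is an element of the factor `H b` outside the edge group
generated by `c b`, and consecutive elements belong to different factors. -/
structure IsReducedSeq {F : Type*} [Group F] (H : Bool → Subgroup F) (c : Bool → F)
    (l : List (Bool × F)) : Prop where
  chain : l.IsChain fun x y => x.1 ≠ y.1
  mem : ∀ x ∈ l, x.2 ∈ H x.1
  notMem : ∀ x ∈ l, x.2 ∉ Subgroup.zpowers (c x.1)

/-- A homomorphism `φ : F →* G` that presents the subgroup generated by the images of `H true` and
`H false` as their amalgam over an infinite cyclic group: the elements `c b` of the factors have
the same image `t` of infinite order, and no nonempty reduced sequence has its product mapped to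
a power of `t`. The factors are kept as subgroups of one group `F`, here the free group on all
letters, so that sequences of elements have no dependent types. -/
structure CyclicAmalgam (F G : Type*) [Group F] [Group G] where
  φ : F →* G
  H : Bool → Subgroup F
  c : Bool → F
  t : G
  c_mem : ∀ b, c b ∈ H b
  map_c : ∀ b, φ (c b) = t
  normalForm : ∀ l : List (Bool × F), l ≠ [] → IsReducedSeq H c l →
    ∀ k : ℤ, φ (l.map Prod.snd).prod ≠ t ^ k
  zpow_ne_one : ∀ k : ℤ, t ^ k = 1 → k = 0

namespace IsReducedSeq

variable {F : Type*} [Group F] {H : Bool → Subgroup F} {c : Bool → F}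

theorem nil : IsReducedSeq H c [] := ⟨.nil, by simp, by simp⟩

theorem tail {x : Bool × F} {l : List (Bool × F)} (h : IsReducedSeq H c (x :: l)) :
    IsReducedSeq H c l :=
  ⟨h.chain.tail, fun y hy => h.mem y (by simp [hy]), fun y hy => h.notMem y (by simp [hy])⟩

theorem cons {b : Bool} {g : F} {l : List (Bool × F)} (h : IsReducedSeq H c l)
    (hl : ∀ x ∈ l.head?, b ≠ x.1) (hg : g ∈ H b) (hg' : g ∉ Subgroup.zpowers (c b)) :
    IsReducedSeq H c ((b, g) :: l) where
  chain := List.isChain_cons.2 ⟨hl, h.chain⟩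
  mem := List.forall_mem_cons.2 ⟨hg, h.mem⟩
  notMem := List.forall_mem_cons.2 ⟨hg', h.notMem⟩

theorem cons_iff {b : Bool} {g : F} {l : List (Bool × F)} : IsReducedSeq H c ((b, g) :: l) ↔
    IsReducedSeq H c l ∧ (∀ x ∈ l.head?, b ≠ x.1) ∧ g ∈ H b ∧ g ∉ Subgroup.zpowers (c b) :=
  ⟨fun h => ⟨h.tail, (List.isChain_cons.1 h.chain).1, h.mem (b, g) (by simp),
    h.notMem (b, g) (by simp)⟩, fun h => h.1.cons h.2.1 h.2.2.1 h.2.2.2⟩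

theorem append {l m : List (Bool × F)} (hl : IsReducedSeq H c l) (hm : IsReducedSeq H c m)
    (h : ∀ x ∈ l.getLast?, ∀ y ∈ m.head?, x.1 ≠ y.1) : IsReducedSeq H c (l ++ m) where
  chain := List.isChain_append.2 ⟨hl.chain, hm.chain, h⟩
  mem x hx := (List.mem_append.1 hx).elim (hl.mem x) (hm.mem x)
  notMem x hx := (List.mem_append.1 hx).elim (hl.notMem x) (hm.notMem x)

/-- The sequence of the inverses in reverse order. -/
def invSeq (l : List (Bool × F)) : List (Bool × F) := (l.map fun x => (x.1, x.2⁻¹)).reverse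

theorem invSeq_prod (l : List (Bool × F)) :
    ((invSeq l).map Prod.snd).prod = (l.map Prod.snd).prod⁻¹ := by
  induction l with
  | nil => simp [invSeq]
  | cons x l ih => simp_all [invSeq]

theorem inv {l : List (Bool × F)} (h : IsReducedSeq H c l) : IsReducedSeq H c (invSeq l) where
  chain := by
    rw [invSeq, List.isChain_reverse, List.isChain_map]
    exact h.chain.imp fun _ _ h => h.symm
  mem x hx := by
    simp only [invSeq, List.mem_reverse, List.mem_map] at hx
    obtain ⟨y, hy, rfl⟩ := hx
    exact inv_mem (h.mem y hy)
  notMem x hx := by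
    simp only [invSeq, List.mem_reverse, List.mem_map] at hx
    obtain ⟨y, hy, rfl⟩ := hx
    simpa using h.notMem y hy

theorem getLast?_invSeq (l : List (Bool × F)) :
    (invSeq l).getLast? = l.head?.map fun x => (x.1, x.2⁻¹) := by
  simp [invSeq]

end IsReducedSeq

namespace CyclicAmalgam

open IsReducedSeq

variable {F G : Type*} [Group F] [Group G] (A : CyclicAmalgam F G)

/-- The element of `G` that is represented by a sequence of elements of the factors. -/
def val (l : List (Bool × F)) : G := A.φ (l.map Prod.snd).prod

@[simp] theorem val_nil : A.val [] = 1 := by simp [val]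

@[simp] theorem val_cons (b : Bool) (g : F) (l : List (Bool × F)) :
    A.val ((b, g) :: l) = A.φ g * A.val l := by simp [val]

theorem map_zpow_c (b : Bool) (k : ℤ) : A.φ (A.c b ^ k) = A.t ^ k := by
  rw [map_zpow, A.map_c]

theorem eq_nil_of_val_eq {l : List (Bool × F)} (hl : IsReducedSeq A.H A.c l) {k : ℤ}
    (h : A.val l = A.t ^ k) : l = [] := by
  by_contra h0
  exact A.normalForm l h0 hl k h

/-- Normal forms are unique up to moving powers of `t`: the first elements of two sequences with the
same value lie in the same factor, and differ by a power of `c b` that passes to the rest. -/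
theorem exists_of_val_cons_eq {b : Bool} {g : F} {l m : List (Bool × F)} {j k : ℤ}
    (hl : IsReducedSeq A.H A.c ((b, g) :: l)) (hm : IsReducedSeq A.H A.c m)
    (h : A.t ^ j * A.val ((b, g) :: l) = A.t ^ k * A.val m) :
    ∃ (g' : F) (m' : List (Bool × F)) (i : ℤ), m = (b, g') :: m' ∧
      A.c b ^ j * g * A.c b ^ (-i) = A.c b ^ k * g' ∧ A.t ^ i * A.val l = A.val m' := by
  obtain ⟨hl', hlh, hgH, hgc⟩ := cons_iff.1 hl
  have hcz : ∀ k : ℤ, A.c b ^ k ∈ Subgroup.zpowers (A.c b) := Subgroup.zpow_mem_zpowers _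
  have hval : ∀ l, A.val (invSeq l) = (A.val l)⁻¹ := fun l => by
    rw [val, invSeq_prod, map_inv, val]
  have happ : ∀ l l', A.val (l ++ l') = A.val l * A.val l' := fun l l' => by simp [val]
  have hne : ∀ (x : F) (m' : List (Bool × F)), IsReducedSeq A.H A.c ((b, x) :: m') →
      A.val l ≠ A.φ x * A.val m' := by
    intro x m' hx he
    have hr : IsReducedSeq A.H A.c (invSeq l ++ (b, x) :: m') := by
      refine hl'.inv.append hx fun y hy z hz => ?_
      rw [getLast?_invSeq] at hy
      simp only [Option.mem_def, Option.map_eq_some_iff] at hy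
      obtain ⟨y', hy', rfl⟩ := hy
      simp only [List.head?_cons, Option.mem_def, Option.some.injEq] at hz
      subst hz
      exact (hlh y' hy').symm
    refine A.normalForm _ (by simp) hr 0 ?_
    change A.val _ = _
    rw [happ, hval, val_cons, he]
    simp
  rw [val_cons] at h
  by_cases hmb : ∀ x ∈ m.head?, b ≠ x.1
  · exfalso
    refine hne (g⁻¹ * A.c b ^ (-j) * A.c b ^ k) m (hm.cons hmb ?_ ?_) ?_
    · exact mul_mem (mul_mem (inv_mem hgH) (zpow_mem (A.c_mem b) _)) (zpow_mem (A.c_mem b) _)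
    · rwa [Subgroup.mul_mem_cancel_right _ (hcz _), Subgroup.mul_mem_cancel_right _ (hcz _),
        inv_mem_iff]
    · simp only [map_mul, map_inv, map_zpow_c, mul_assoc]
      rw [← h]
      simp
  · push Not at hmb
    obtain ⟨⟨b', g'⟩, hx, rfl⟩ := hmb
    obtain ⟨m', rfl⟩ : ∃ m', m = (b, g') :: m' := by
      cases m with
      | nil => simp at hx
      | cons y m' => simp at hx; exact ⟨m', by rw [hx]⟩
    obtain ⟨hm', hmh, hgH', hgc'⟩ := cons_iff.1 hm
    rw [val_cons] at h
    have hz : g⁻¹ * A.c b ^ (-j) * A.c b ^ k * g' ∈ Subgroup.zpowers (A.c b) := by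
      by_contra hz
      refine hne (g⁻¹ * A.c b ^ (-j) * A.c b ^ k * g') m' (hm'.cons hmh ?_ hz) ?_
      · exact mul_mem (mul_mem (mul_mem (inv_mem hgH) (zpow_mem (A.c_mem _) _))
          (zpow_mem (A.c_mem _) _)) hgH'
      · simp only [map_mul, map_inv, map_zpow_c, mul_assoc]
        rw [← h]
        simp
    obtain ⟨i, hi⟩ := hz
    simp only at hi
    refine ⟨g', m', -i, rfl, ?_, ?_⟩
    · rw [neg_neg, hi]; group
    · have h2 : A.t ^ i * A.val m' = A.val l := by
        rw [← A.map_zpow_c b, hi]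
        simp only [map_mul, map_inv, map_zpow_c, mul_assoc]
        rw [← h]
        simp
      rw [← h2]; simp

/-- The submonoid of `G` generated by the images of the submonoids `N b`. -/
def span (N : Bool → Submonoid F) : Submonoid G :=
  Submonoid.closure {g | ∃ b, ∃ x ∈ N b, A.φ x = g}

variable {N : Bool → Submonoid F}

theorem mem_span {b : Bool} {x : F} (hx : x ∈ N b) : A.φ x ∈ A.span N :=
  Submonoid.subset_closure ⟨b, x, hx, rfl⟩

/-- If the submonoids `N b` contain the same powers of the edge generators, then every element of
the submonoid generated by their images has a normal form that consists of elements of them. -/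
theorem exists_form (hNH : ∀ b, ∀ x ∈ N b, x ∈ A.H b)
    (hN : ∀ (b b') (k : ℤ), A.c b ^ k ∈ N b → A.c b' ^ k ∈ N b') {p : G} (hp : p ∈ A.span N) :
    ∃ (k : ℤ) (l : List (Bool × F)), IsReducedSeq A.H A.c l ∧ (∀ x ∈ l, x.2 ∈ N x.1) ∧
      (∀ b, A.c b ^ k ∈ N b) ∧ p = A.t ^ k * A.val l := by
  induction hp using Submonoid.closure_induction_left with
  | one => exact ⟨0, [], nil, by simp, fun b => by simp, by simp⟩
  | mul_left x hx y _ ih =>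
    obtain ⟨b, n, hn, rfl⟩ := hx
    obtain ⟨k, l, hl, hlN, hk, rfl⟩ := ih
    have push : ∀ (g : F) (m : List (Bool × F)), g ∈ N b → IsReducedSeq A.H A.c m →
        (∀ x ∈ m, x.2 ∈ N x.1) → (∀ x ∈ m.head?, b ≠ x.1) →
        ∃ (k : ℤ) (l : List (Bool × F)), IsReducedSeq A.H A.c l ∧ (∀ x ∈ l, x.2 ∈ N x.1) ∧
          (∀ b, A.c b ^ k ∈ N b) ∧ A.φ g * A.val m = A.t ^ k * A.val l := by
      intro g m hg hm hmN hmb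
      by_cases hgc : g ∈ Subgroup.zpowers (A.c b)
      · obtain ⟨i, rfl⟩ := hgc
        exact ⟨i, m, hm, hmN, fun b' => hN b b' i hg, by simp only [map_zpow_c]⟩
      · exact ⟨0, (b, g) :: m, hm.cons hmb (hNH b g hg) hgc, List.forall_mem_cons.2 ⟨hg, hmN⟩,
          fun b' => by simp, by simp⟩
    by_cases hlb : ∀ x ∈ l.head?, b ≠ x.1
    · obtain ⟨k', l', h1, h2, h3, h4⟩ := push (n * A.c b ^ k) l (mul_mem hn (hk b)) hl hlN hlb
      exact ⟨k', l', h1, h2, h3, by rw [← h4, map_mul, map_zpow_c, mul_assoc]⟩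
    · push Not at hlb
      obtain ⟨⟨b', g⟩, hx, rfl⟩ := hlb
      obtain ⟨m, rfl⟩ : ∃ m, l = (b, g) :: m := by
        cases l with
        | nil => simp at hx
        | cons y m => simp at hx; exact ⟨m, by rw [hx]⟩
      obtain ⟨hm, hmh, -, -⟩ := cons_iff.1 hl
      have hgN : g ∈ N b := hlN (b, g) (by simp)
      obtain ⟨k', l', h1, h2, h3, h4⟩ := push (n * A.c b ^ k * g) m
        (mul_mem (mul_mem hn (hk b)) hgN) hm (fun x hx => hlN x (by simp [hx])) hmh
      exact ⟨k', l', h1, h2, h3, by rw [← h4]; simp [map_zpow_c, mul_assoc]⟩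

/-- Membership of a normal form in the submonoid is decided from the right: the exponents allowed
in front of a sequence are determined by those allowed in front of its tail. -/
theorem val_cons_mem_span_iff (hNH : ∀ b, ∀ x ∈ N b, x ∈ A.H b)
    (hN : ∀ (b b') (k : ℤ), A.c b ^ k ∈ N b → A.c b' ^ k ∈ N b') {b : Bool} {g : F}
    {l : List (Bool × F)} (hl : IsReducedSeq A.H A.c ((b, g) :: l)) (j : ℤ) :
    A.t ^ j * A.val ((b, g) :: l) ∈ A.span N ↔
      ∃ i : ℤ, A.t ^ i * A.val l ∈ A.span N ∧ A.c b ^ j * g * A.c b ^ (-i) ∈ N b := by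
  constructor
  · intro h
    obtain ⟨k, m, hm, hmN, hk, h⟩ := A.exists_form hNH hN h
    obtain ⟨g', m', i, rfl, h1, h2⟩ := A.exists_of_val_cons_eq hl hm h
    refine ⟨i, ?_, ?_⟩
    · have : ∀ m : List (Bool × F), (∀ x ∈ m, x.2 ∈ N x.1) → A.val m ∈ A.span N := by
        intro m hm
        induction m with
        | nil => simp
        | cons x m ih =>
          simp only [List.mem_cons, forall_eq_or_imp] at hm
          exact A.val_cons x.1 x.2 m ▸ mul_mem (A.mem_span hm.1) (ih hm.2)
      rw [h2]
      exact this _ fun x hx => hmN x (by simp [hx])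
    · rw [h1]
      exact mul_mem (hk b) (hmN (b, g') (by simp))
  · rintro ⟨i, h1, h2⟩
    have := mul_mem (A.mem_span h2) h1
    simp only [map_mul, map_zpow_c, mul_assoc] at this
    rw [val_cons]
    simpa using this

end CyclicAmalgam

/-! ### The pinched one-relator group as an amalgam -/

namespace PinchedPresentation

open FreeGroup (mul_mk inv_mk invRev)

variable {X Y : Type*}

/-- The two sides of the relation `u = v` as words over `X ⊕ Y`: `u` for `true`, `v` for `false`. -/
def side (u : GWord X) (v : GWord Y) (b : Bool) : GWord (X ⊕ Y) :=
  bif b then u.mapAlphabet Sum.inl else v.mapAlphabet Sum.inr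

variable (X Y) in
/-- The subgroup of the free group on `X ⊕ Y` generated by `X` (for `true`) or by `Y` (for
`false`). -/
def factor (b : Bool) : Subgroup (FreeGroup (X ⊕ Y)) :=
  Subgroup.closure (FreeGroup.of '' {z | z.isLeft = b})

theorem mk_mem_factor {b : Bool} {s : GWord (X ⊕ Y)} (hs : ∀ x ∈ s, x.1.isLeft = b) :
    FreeGroup.mk s ∈ factor X Y b := by
  induction s with
  | nil => exact one_mem _
  | cons x s ih =>
    simp only [List.mem_cons, forall_eq_or_imp] at hs
    rw [← List.singleton_append, ← mul_mk]
    refine mul_mem ?_ (ih hs.2)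
    have h : FreeGroup.of x.1 ∈ factor X Y b := Subgroup.subset_closure ⟨x.1, hs.1, rfl⟩
    obtain ⟨z, _ | _⟩ := x
    · exact inv_mem h
    · exact h

variable (u : GWord X) (v : GWord Y)

theorem isLeft_of_mem_side {b : Bool} {x : (X ⊕ Y) × Bool} (hx : x ∈ side u v b) :
    x.1.isLeft = b := by
  cases b <;>
  · simp only [side, GWord.mapAlphabet, cond_true, cond_false, List.mem_map] at hx
    obtain ⟨y, -, rfl⟩ := hx
    rfl

theorem mk_side_mem_factor (b : Bool) : FreeGroup.mk (side u v b) ∈ factor X Y b :=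
  mk_mem_factor fun _ => isLeft_of_mem_side u v

variable {u v}

theorem isReduced_side (hur : FreeGroup.IsReduced u) (hvr : FreeGroup.IsReduced v) (b : Bool) :
    FreeGroup.IsReduced (side u v b) := by
  cases b <;>
  · simp only [side, GWord.mapAlphabet, cond_true, cond_false, FreeGroup.IsReduced,
      List.isChain_map]
    simpa [FreeGroup.IsReduced] using ‹_›

theorem side_ne_nil (hu : u ≠ []) (hv : v ≠ []) (b : Bool) : side u v b ≠ [] := by
  cases b <;> simpa [side, GWord.mapAlphabet]

theorem mk_ne_one {α : Type*} {w : List (α × Bool)} (hw : FreeGroup.IsReduced w) (h : w ≠ []) :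
    FreeGroup.mk w ≠ 1 := by
  classical
  intro h1
  have := FreeGroup.reduce.sound (h1.trans FreeGroup.one_eq_mk)
  rw [hw.reduce_eq, FreeGroup.reduce_nil] at this
  exact h this

theorem pinchedRelator_eq (u : GWord X) (v : GWord Y) :
    pinchedRelator u v = side u v true ++ invRev (side u v false) := rfl

section

variable (u v)

/-- The homomorphism from the infinite cyclic group that takes the generator to `u` or to `v`. -/
def edgeHom (b : Bool) : Multiplicative ℤ →* factor X Y b :=
  zpowersHom _ ⟨FreeGroup.mk (side u v b), mk_side_mem_factor u v b⟩

/-- The image of a letter in the pushout of the two factors over the infinite cyclic group. -/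
def toPushoutFun (z : X ⊕ Y) : Monoid.PushoutI (edgeHom u v) :=
  Monoid.PushoutI.of z.isLeft ⟨FreeGroup.of z, Subgroup.subset_closure ⟨z, rfl, rfl⟩⟩

theorem lift_toPushoutFun {b : Bool} {g : FreeGroup (X ⊕ Y)} (hg : g ∈ factor X Y b) :
    FreeGroup.lift (toPushoutFun u v) g = Monoid.PushoutI.of b ⟨g, hg⟩ := by
  induction hg using Subgroup.closure_induction with
  | mem x hx =>
    obtain ⟨z, rfl, rfl⟩ := hx
    rw [FreeGroup.lift_apply_of]
    rfl
  | one => exact (map_one _).trans (map_one (Monoid.PushoutI.of b)).symm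
  | mul x y hx hy h1 h2 => rw [map_mul, h1, h2, ← map_mul]; rfl
  | inv x hx h => rw [map_inv, h, ← map_inv]; rfl

theorem lift_toPushoutFun_side (b : Bool) (k : ℤ) :
    FreeGroup.lift (toPushoutFun u v) (FreeGroup.mk (side u v b) ^ k) =
      Monoid.PushoutI.base (edgeHom u v) (Multiplicative.ofAdd k) := by
  rw [← Monoid.PushoutI.of_apply_eq_base (edgeHom u v) b,
    lift_toPushoutFun u v (zpow_mem (mk_side_mem_factor u v b) k)]
  rfl

/-- The homomorphism from `Gp⟨X ∪ Y | u v⁻¹ = 1⟩` to the pushout of the two free factors, through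
which normal forms in the pushout are transferred. -/
def toPushout : OneRelGroup (pinchedRelator u v) →* Monoid.PushoutI (edgeHom u v) :=
  PresentedGroup.toGroup (f := toPushoutFun u v) <| by
    rintro _ rfl
    have h1 := lift_toPushoutFun_side u v true 1
    have h2 := lift_toPushoutFun_side u v false 1
    rw [zpow_one] at h1 h2
    rw [pinchedRelator_eq, ← mul_mk, ← inv_mk, map_mul, map_inv, h1, h2, mul_inv_cancel]

theorem toPushout_mk (g : FreeGroup (X ⊕ Y)) :
    toPushout u v (PresentedGroup.mk _ g) = FreeGroup.lift (toPushoutFun u v) g := rfl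

theorem mk_side_eq (b : Bool) :
    PresentedGroup.mk {FreeGroup.mk (pinchedRelator u v)} (FreeGroup.mk (side u v b)) =
      PresentedGroup.mk {FreeGroup.mk (pinchedRelator u v)} (FreeGroup.mk (side u v true)) := by
  cases b
  · have : PresentedGroup.mk {FreeGroup.mk (pinchedRelator u v)}
        (FreeGroup.mk (pinchedRelator u v)) = 1 := PresentedGroup.one_of_mem rfl
    rw [pinchedRelator_eq, ← mul_mk, ← inv_mk, map_mul, map_inv, mul_inv_eq_one] at this
    exact this.symm
  · rfl

end

theorem edgeHom_injective (hu : u ≠ []) (hv : v ≠ []) (hur : FreeGroup.IsReduced u)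
    (hvr : FreeGroup.IsReduced v) (b : Bool) : Function.Injective (edgeHom u v b) := by
  rw [injective_iff_map_eq_one]
  intro k hk
  have h : FreeGroup.mk (side u v b) ^ (Multiplicative.toAdd k) = 1 := congrArg Subtype.val hk
  exact (IsMulTorsionFree.zpow_eq_one_iff_right
    (mk_ne_one (isReduced_side hur hvr b) (side_ne_nil hu hv b))).1 h

variable (u v) in
/-- `Gp⟨X ∪ Y | u v⁻¹ = 1⟩` is the amalgam of the free groups on `X` and on `Y` over the infinite
cyclic groups generated by `u` and by `v`. -/
def amalgam (hu : u ≠ []) (hv : v ≠ []) (hur : FreeGroup.IsReduced u)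
    (hvr : FreeGroup.IsReduced v) :
    CyclicAmalgam (FreeGroup (X ⊕ Y)) (OneRelGroup (pinchedRelator u v)) where
  φ := PresentedGroup.mk _
  H := factor X Y
  c b := FreeGroup.mk (side u v b)
  t := PresentedGroup.mk _ (FreeGroup.mk (side u v true))
  c_mem := mk_side_mem_factor u v
  map_c := mk_side_eq u v
  normalForm l hl0 hl k h := by
    let W : Monoid.CoprodI.Word (fun b => factor X Y b) :=
      { toList := l.pmap (fun x hx => ⟨x.1, ⟨x.2, hx⟩⟩) hl.mem
        ne_one := by
          intro x hx h1
          obtain ⟨y, hy, rfl⟩ := List.mem_pmap.1 hx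
          have : y.2 = 1 := congrArg Subtype.val h1
          exact hl.notMem y hy (this ▸ one_mem _)
        chain_ne := by
          refine List.isChain_pmap_of_isChain ?_ hl.chain hl.mem
          exact fun _ _ _ _ h => h }
    have hW : Monoid.PushoutI.Reduced (edgeHom u v) W := by
      rintro x hx ⟨j, hj⟩
      obtain ⟨y, hy, rfl⟩ := List.mem_pmap.1 hx
      exact hl.notMem y hy ⟨Multiplicative.toAdd j, congrArg Subtype.val hj⟩
    have hprod : Monoid.PushoutI.ofCoprodI W.prod =
        FreeGroup.lift (toPushoutFun u v) (l.map Prod.snd).prod := by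
      simp only [W, Monoid.CoprodI.Word.prod, map_list_prod, List.map_pmap, List.map_map]
      rw [← List.pmap_eq_map (p := fun x : Bool × FreeGroup (X ⊕ Y) => x.2 ∈ factor X Y x.1)
        (H := hl.mem)]
      refine congrArg _ (List.pmap_congr_left _ fun x _ hx _ => ?_)
      simp only [Function.comp, Monoid.PushoutI.ofCoprodI_of]
      exact (lift_toPushoutFun u v hx).symm
    have := hW.eq_empty_of_mem_range (edgeHom_injective hu hv hur hvr)
      ⟨Multiplicative.ofAdd k, by
        rw [hprod, ← toPushout_mk, h, ← map_zpow, toPushout_mk, lift_toPushoutFun_side]⟩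
    have h2 : W.toList = [] := by rw [this]; rfl
    exact hl0 (by simpa [W] using h2)
  zpow_ne_one k h := by
    have h2 := congrArg (toPushout u v) h
    rw [← map_zpow, toPushout_mk, lift_toPushoutFun_side, map_one (toPushout u v)] at h2
    have := Monoid.PushoutI.base_injective (edgeHom_injective hu hv hur hvr)
      (h2.trans (map_one _).symm)
    exact this

end PinchedPresentation

/-! ### Generators of the prefix monoid -/

namespace PinchedPresentation

open FreeGroup (mul_mk inv_mk invRev)
open OneRelGroup (ofWord_append ofWord_invRev)

variable {X Y : Type*} (u : GWord X) (v : GWord Y)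

theorem ofWord_side (b b' : Bool) : OneRelGroup.ofWord (pinchedRelator u v) (side u v b) =
    OneRelGroup.ofWord (pinchedRelator u v) (side u v b') :=
  (mk_side_eq u v b).trans (mk_side_eq u v b').symm

/-- The prefix `u q⁻¹` of `u v⁻¹`, for `v = p q`, represents the same element as the prefix `p` of
`v`, because `u = v` in the group. -/
theorem ofWord_mem_prefixMonoid {b : Bool} {p : GWord (X ⊕ Y)} (hp : p <+: side u v b) :
    OneRelGroup.ofWord (pinchedRelator u v) p ∈ prefixMonoid (pinchedRelator u v) := by
  obtain ⟨r, hr⟩ := hp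
  cases b
  · refine Submonoid.subset_closure ⟨side u v true ++ invRev r, ?_, ?_⟩
    · exact ⟨invRev p, by rw [pinchedRelator_eq, ← hr]; simp⟩
    · rw [ofWord_append, ofWord_side u v true false, ← hr, ofWord_append, ofWord_invRev,
        mul_inv_cancel_right]
  · exact Submonoid.subset_closure ⟨p, ⟨r ++ invRev (side u v false), by
      rw [pinchedRelator_eq, ← hr]; simp⟩, rfl⟩

theorem exists_prefix_of_prefix {p : GWord (X ⊕ Y)} (hp : p <+: pinchedRelator u v) :
    ∃ (b : Bool) (q : GWord (X ⊕ Y)), q <+: side u v b ∧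
      OneRelGroup.ofWord (pinchedRelator u v) q = OneRelGroup.ofWord (pinchedRelator u v) p := by
  obtain ⟨q, hq⟩ := hp
  rw [pinchedRelator_eq] at hq
  rcases List.append_eq_append_iff.1 hq with ⟨z, h1, h2⟩ | ⟨z, h1, h2⟩
  · exact ⟨true, p, ⟨z, h1.symm⟩, rfl⟩
  · have h3 := congrArg invRev h2
    rw [FreeGroup.invRev_invRev, FreeGroup.invRev_append] at h3
    refine ⟨false, invRev q, ⟨_, h3.symm⟩, ?_⟩
    rw [h1, ofWord_append, ofWord_side u v true false, h3, ofWord_append, ofWord_invRev _ z,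
      inv_mul_cancel_right]

variable {u v} (hu : u ≠ []) (hv : v ≠ []) (hur : FreeGroup.IsReduced u)
  (hvr : FreeGroup.IsReduced v)

theorem span_prefix_eq : (amalgam u v hu hv hur hvr).span
    (fun b => Submonoid.closure (FreeGroup.mk '' {p | p <+: side u v b})) =
      prefixMonoid (pinchedRelator u v) := by
  apply le_antisymm
  · refine Submonoid.closure_le.2 ?_
    rintro _ ⟨b, x, hx, rfl⟩
    have : Submonoid.closure (FreeGroup.mk '' {p | p <+: side u v b}) ≤
        (prefixMonoid (pinchedRelator u v)).comap (amalgam u v hu hv hur hvr).φ := by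
      refine Submonoid.closure_le.2 ?_
      rintro _ ⟨p, hp, rfl⟩
      exact ofWord_mem_prefixMonoid u v hp
    exact this hx
  · refine Submonoid.closure_le.2 ?_
    rintro _ ⟨p, hp, rfl⟩
    obtain ⟨b, q, hq, h⟩ := exists_prefix_of_prefix u v hp
    rw [← h]
    exact (amalgam u v hu hv hur hvr).mem_span (N := fun b =>
      Submonoid.closure (FreeGroup.mk '' {p | p <+: side u v b})) (b := b)
      (Submonoid.subset_closure ⟨q, hq, rfl⟩)

/-- The prefix monoid is generated by the images of two finitely generated submonoids of the free
factors that contain the same powers of the two sides of the relation. The prefixes of `u` and `v`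
do this when neither monoid contains the inverse of its side, for then both contain exactly the
nonnegative powers. Otherwise the inverse of the common element is in the prefix monoid, and the
inverse words can be added to both sets of generators. -/
theorem exists_generators : ∃ W : Bool → Set (GWord (X ⊕ Y)),
    (∀ b, (W b).Finite) ∧ (∀ b, side u v b ∈ W b) ∧ (∀ b, ∀ s ∈ W b, ∀ x ∈ s, x.1.isLeft = b) ∧
    (∀ (b b' : Bool) (k : ℤ),
      FreeGroup.mk (side u v b) ^ k ∈ Submonoid.closure (FreeGroup.mk '' W b) →
      FreeGroup.mk (side u v b') ^ k ∈ Submonoid.closure (FreeGroup.mk '' W b')) ∧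
    (amalgam u v hu hv hur hvr).span (fun b => Submonoid.closure (FreeGroup.mk '' W b)) =
      prefixMonoid (pinchedRelator u v) := by
  classical
  set A := amalgam u v hu hv hur hvr with hA
  have hfin : ∀ b, {p | p <+: side u v b}.Finite := fun b => by
    refine (List.finite_toSet (side u v b).inits).subset fun p hp => ?_
    exact (List.mem_inits _ _).2 hp
  have hsub : ∀ b, ∀ s ∈ {p | p <+: side u v b}, ∀ x ∈ s, x.1.isLeft = b :=
    fun b s hs x hx => isLeft_of_mem_side u v (hs.subset hx)
  have hside : ∀ b, side u v b ∈ {p | p <+: side u v b} := fun b => List.prefix_rfl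
  by_cases hc : ∃ b, (FreeGroup.mk (side u v b))⁻¹ ∈
      Submonoid.closure (FreeGroup.mk '' {p | p <+: side u v b})
  · obtain ⟨b₀, hb₀⟩ := hc
    refine ⟨fun b => insert (invRev (side u v b)) {p | p <+: side u v b},
      fun b => (hfin b).insert _, fun b => Set.mem_insert_of_mem _ (hside b), ?_, ?_, ?_⟩
    · rintro b s (rfl | hs) x hx
      · rw [invRev, List.mem_reverse, List.mem_map] at hx
        obtain ⟨y, hy, rfl⟩ := hx
        exact isLeft_of_mem_side u v (x := y) hy
      · exact hsub b s hs x hx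
    · intro _ b k _
      have h1 : FreeGroup.mk (side u v b) ∈ Submonoid.closure (FreeGroup.mk ''
          insert (invRev (side u v b)) {p | p <+: side u v b}) :=
        Submonoid.subset_closure ⟨_, Set.mem_insert_of_mem _ (hside b), rfl⟩
      have h2 : (FreeGroup.mk (side u v b))⁻¹ ∈ Submonoid.closure (FreeGroup.mk ''
          insert (invRev (side u v b)) {p | p <+: side u v b}) :=
        Submonoid.subset_closure ⟨_, Set.mem_insert _ _, rfl⟩
      obtain ⟨n, rfl | rfl⟩ := k.eq_nat_or_neg
      · rw [zpow_natCast]; exact pow_mem h1 n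
      · rw [zpow_neg, zpow_natCast, ← inv_pow]; exact pow_mem h2 n
    · rw [← span_prefix_eq hu hv hur hvr]
      apply le_antisymm
      · refine Submonoid.closure_le.2 ?_
        rintro _ ⟨b, x, hx, rfl⟩
        suffices h : Submonoid.closure (FreeGroup.mk ''
            insert (invRev (side u v b)) {p | p <+: side u v b}) ≤
            (A.span fun b =>
              Submonoid.closure (FreeGroup.mk '' {p | p <+: side u v b})).comap A.φ from h hx
        refine Submonoid.closure_le.2 ?_
        rintro _ ⟨p, rfl | hp, rfl⟩
        · have h3 := A.mem_span (N := fun b =>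
            Submonoid.closure (FreeGroup.mk '' {p | p <+: side u v b})) hb₀
          have h4 : A.φ (FreeGroup.mk (invRev (side u v b))) =
              A.φ (FreeGroup.mk (side u v b₀))⁻¹ := by
            rw [← inv_mk, map_inv, map_inv]
            exact congrArg _ ((A.map_c b).trans (A.map_c b₀).symm)
          change A.φ (FreeGroup.mk (invRev (side u v b))) ∈
            A.span fun b => Submonoid.closure (FreeGroup.mk '' {p | p <+: side u v b})
          rw [h4]
          exact h3
        · exact A.mem_span (N := fun b =>
            Submonoid.closure (FreeGroup.mk '' {p | p <+: side u v b})) (b := b)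
            (Submonoid.subset_closure ⟨p, hp, rfl⟩)
      · refine Submonoid.closure_mono ?_
        rintro _ ⟨b, x, hx, rfl⟩
        exact ⟨b, x, Submonoid.closure_mono (Set.image_mono (Set.subset_insert _ _)) hx, rfl⟩
  · push Not at hc
    refine ⟨fun b => {p | p <+: side u v b}, hfin, hside, hsub, ?_, span_prefix_eq hu hv hur hvr⟩
    intro b b' k hk
    have h1 : ∀ b, FreeGroup.mk (side u v b) ∈
        Submonoid.closure (FreeGroup.mk '' {p | p <+: side u v b}) := fun b =>
      Submonoid.subset_closure ⟨_, hside b, rfl⟩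
    obtain ⟨n, rfl | rfl⟩ := k.eq_nat_or_neg
    · rw [zpow_natCast]; exact pow_mem (h1 b') n
    · rcases n with _ | n
      · simp
      · exfalso
        refine hc b ?_
        have := mul_mem hk (pow_mem (h1 b) n)
        rwa [← zpow_natCast, ← zpow_add,
          show (-((n + 1 : ℕ) : ℤ) + (n : ℤ)) = -1 by push_cast; ring, zpow_neg_one] at this

end PinchedPresentation

/-! ### Computability of operations on words -/

section Computability

open Encodable

variable {α β γ : Type*} [Primcodable α] [Primcodable β] [Primcodable γ]

theorem ComputablePred.comp {p : β → Prop} {f : α → β} (hp : ComputablePred p)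
    (hf : Computable f) : ComputablePred fun a => p (f a) := by
  obtain ⟨g, hg, rfl⟩ := ComputablePred.computable_iff.1 hp
  exact ComputablePred.computable_iff.2 ⟨_, hg.comp hf, rfl⟩

theorem ComputablePred.and {p q : α → Prop} (hp : ComputablePred p) (hq : ComputablePred q) :
    ComputablePred fun a => p a ∧ q a := by
  obtain ⟨f, hf, rfl⟩ := ComputablePred.computable_iff.1 hp
  obtain ⟨g, hg, rfl⟩ := ComputablePred.computable_iff.1 hq
  exact ComputablePred.computable_iff.2
    ⟨_, Primrec.and.to_comp.comp hf hg, funext fun a => by simp⟩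

theorem ComputablePred.or {p q : α → Prop} (hp : ComputablePred p) (hq : ComputablePred q) :
    ComputablePred fun a => p a ∨ q a :=
  (hp.not.and hq.not).not.of_eq fun a => by tauto

theorem ComputablePred.forall_lt {p : α × ℕ → Prop} (hp : ComputablePred p) {f : α → ℕ}
    (hf : Computable f) : ComputablePred fun a => ∀ i < f a, p (a, i) := by
  obtain ⟨g, hg, rfl⟩ := ComputablePred.computable_iff.1 hp
  refine ComputablePred.computable_iff.2 ⟨fun a => Nat.rec true (fun i b => b && g (a, i)) (f a),
    Computable.nat_rec (h := fun a p => p.2 && g (a, p.1)) hf (Computable.const true) ?_,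
    funext fun a => propext ?_⟩
  · exact Primrec.and.to_comp.comp (Computable.snd.comp Computable.snd)
      (hg.comp (Computable.fst.pair (Computable.fst.comp Computable.snd)))
  · dsimp only
    generalize f a = n
    induction n with
    | zero => simp
    | succ n ih =>
      simp only [Nat.lt_succ_iff_lt_or_eq, or_imp, forall_and, forall_eq, ih, Bool.and_eq_true]

theorem ComputablePred.exists_lt {p : α × ℕ → Prop} (hp : ComputablePred p) {f : α → ℕ}
    (hf : Computable f) : ComputablePred fun a => ∃ i < f a, p (a, i) :=
  (hp.not.forall_lt hf).not.of_eq fun a => by push Not; rfl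

theorem ComputablePred.exists_mem_option {q : α × γ → Prop} (hq : ComputablePred q)
    {f : α → Option γ} (hf : Computable f) : ComputablePred fun a => ∃ c ∈ f a, q (a, c) := by
  obtain ⟨g, hg, rfl⟩ := ComputablePred.computable_iff.1 hq
  refine ComputablePred.computable_iff.2 ⟨fun a => Option.casesOn (f a) false fun c => g (a, c),
    Computable.option_casesOn (g := fun a c => g (a, c)) hf (Computable.const false) hg.to₂,
    funext fun a => propext ?_⟩
  dsimp only
  generalize f a = o
  cases o <;> simp

/-- Decision by unbounded search: `p` is computable if every instance `a` has a certificate `c`,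
recognized by the computable predicate `r`, from which the answer can be read off computably. -/
theorem ComputablePred.of_certificate {p : α → Prop} {r q : α × γ → Prop} (hr : ComputablePred r)
    (hq : ComputablePred q) (hex : ∀ a, ∃ c, r (a, c)) (h : ∀ a c, r (a, c) → (p a ↔ q (a, c))) :
    ComputablePred p := by
  classical
  have hP : ComputablePred fun x : α × ℕ => ∃ c ∈ (decode x.2 : Option γ), r (x.1, c) :=
    (hr.comp (f := fun y : (α × ℕ) × γ => (y.1.1, y.2))
      ((Computable.fst.comp Computable.fst).pair Computable.snd)).exists_mem_option
      (Computable.decode.comp Computable.snd)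
  have hex' : ∀ a, ∃ n, ∃ c ∈ (decode n : Option γ), r (a, c) := fun a => by
    obtain ⟨c, hc⟩ := hex a
    exact ⟨encode c, c, by simp, hc⟩
  have hf := Computable.find (P := fun a n => ∃ c ∈ (decode n : Option γ), r (a, c)) hP hex'
  refine (hq.exists_mem_option (Computable.decode.comp hf)).of_eq fun a => ?_
  obtain ⟨c, hc, hrc⟩ := Nat.find_spec (hex' a)
  rw [h a c hrc]
  constructor
  · rintro ⟨c', hc', hq'⟩
    rw [Option.mem_def] at hc hc'
    rw [hc] at hc'
    exact Option.some_injective _ hc' ▸ hq'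
  · exact fun hq => ⟨c, hc, hq⟩

end Computability

namespace FreeGroup

variable {α : Type*}

/-- A word that represents the power of `w` with exponent `k.1 - k.2`. Integer exponents are encoded
as differences of natural numbers, which need not be in lowest terms. -/
def zpowWord (w : List (α × Bool)) (k : ℕ × ℕ) : List (α × Bool) :=
  (List.replicate k.1 w).flatten ++ (List.replicate k.2 (invRev w)).flatten

theorem mk_zpowWord (w : List (α × Bool)) (k : ℕ × ℕ) :
    mk (zpowWord w k) = mk w ^ ((k.1 : ℤ) - k.2) := by
  rw [zpowWord, ← mul_mk, ← pow_mk, ← pow_mk, ← inv_mk, zpow_sub, zpow_natCast, zpow_natCast,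
    inv_pow]

variable [Primcodable α]

theorem primrec_reduce [DecidableEq α] : Primrec (reduce : List (α × Bool) → List (α × Bool)) := by
  let step : (α × Bool) × List (α × Bool) → List (α × Bool) := fun p =>
    List.casesOn p.2 [p.1] fun hd tl => if p.1.1 = hd.1 ∧ p.1.2 = !hd.2 then tl else p.1 :: hd :: tl
  have hstep : Primrec step := by
    refine Primrec.list_casesOn (h := fun (p : (α × Bool) × List (α × Bool))
      (q : (α × Bool) × List (α × Bool)) => if p.1.1 = q.1.1 ∧ p.1.2 = !q.1.2 then q.2
        else p.1 :: q.1 :: q.2) Primrec.snd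
      (Primrec.list_cons.comp Primrec.fst (Primrec.const [])) ?_
    refine Primrec.ite (PrimrecPred.and (Primrec.eq.comp ?_ ?_) (Primrec.eq.comp ?_ ?_)) ?_ ?_
    · exact Primrec.fst.comp (Primrec.fst.comp Primrec.fst)
    · exact Primrec.fst.comp (Primrec.fst.comp Primrec.snd)
    · exact Primrec.snd.comp (Primrec.fst.comp Primrec.fst)
    · exact Primrec.not.comp (Primrec.snd.comp (Primrec.fst.comp Primrec.snd))
    · exact Primrec.snd.comp Primrec.snd
    · exact Primrec.list_cons.comp (Primrec.fst.comp Primrec.fst)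
        (Primrec.list_cons.comp (Primrec.fst.comp Primrec.snd) (Primrec.snd.comp Primrec.snd))
  have := Primrec.list_foldr (f := fun l : List (α × Bool) => l) (g := fun _ => [])
    (h := fun _ => step) Primrec.id (Primrec.const []) (hstep.comp Primrec.snd).to₂
  refine this.of_eq fun l => ?_
  induction l with
  | nil => rfl
  | cons x l ih => rw [List.foldr_cons, ih, reduce.cons]

theorem primrec_invRev : Primrec (invRev : List (α × Bool) → List (α × Bool)) :=
  Primrec.list_reverse.comp (Primrec.list_map Primrec.id
    ((Primrec.fst.comp Primrec.snd).pair (Primrec.not.comp (Primrec.snd.comp Primrec.snd))).to₂)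

theorem primrecRel_mk_eq : PrimrecRel fun s t : List (α × Bool) => mk s = mk t := by
  classical
  exact (Primrec.eq.comp (primrec_reduce.comp Primrec.fst) (primrec_reduce.comp Primrec.snd)).of_eq
    fun p => ⟨reduce.exact, reduce.sound⟩

theorem FinitelySplit.primrecPred [Finite α] {R : Set (FreeGroup α)} (hR : FinitelySplit R) :
    PrimrecPred fun s : List (α × Bool) => mk s ∈ R := by
  classical
  obtain ⟨n, D, hD⟩ := hR.exists_dfa
  have h1 : Primrec fun s : List (α × Bool) => D.eval s :=
    Primrec.list_foldl (f := fun l : List (α × Bool) => l) (g := fun _ => D.start)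
      (h := fun _ p => D.step p.1 p.2) Primrec.id (Primrec.const _)
      ((Primrec.dom_finite fun p : Fin n × (α × Bool) => D.step p.1 p.2).comp Primrec.snd).to₂
  have h2 : PrimrecPred fun i : Fin n => i ∈ D.accept := ⟨inferInstance, Primrec.dom_finite _⟩
  refine (h2.comp (h1.comp primrec_reduce)).of_eq fun s => ?_
  rw [← DFA.mem_accepts, ← hD _ (by rw [← toWord_mk]; exact isReduced_toWord), reduce.self]

theorem primrec_zpowWord : Primrec₂ (zpowWord : List (α × Bool) → ℕ × ℕ → List (α × Bool)) := by
  have hrep : Primrec₂ fun (n : ℕ) (w : List (α × Bool)) => (List.replicate n w).flatten := by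
    refine (Primrec.list_flatMap (f := fun p : ℕ × List (α × Bool) => List.range p.1)
      (g := fun p _ => p.2) (Primrec.list_range.comp Primrec.fst)
      (Primrec.snd.comp Primrec.fst).to₂).of_eq fun p => ?_
    rw [List.flatMap_def, List.map_const', List.length_range]
  exact Primrec.list_append.comp
    (hrep.comp (Primrec.fst.comp Primrec.snd) Primrec.fst)
    (hrep.comp (Primrec.snd.comp Primrec.snd) (primrec_invRev.comp Primrec.fst))

end FreeGroup

/-! ### Exponent sets and their codes -/

/-- Codes for the upward closed sets of integers, see `RayCode.Codes`. -/
abbrev RayCode : Type := Option Bool × (ℕ × ℕ)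

/-- The code `v` stands for the set `S`: the tag `some false` means `∅`, `some true` means `ℤ`, and
`none` means the ray of the integers from `v.2.1 - v.2.2` on. -/
def RayCode.Codes (v : RayCode) (S : Set ℤ) : Prop :=
  (v.1 = some false → ∀ j, j ∉ S) ∧ (v.1 = some true → ∀ j, j ∈ S) ∧
    (v.1 = none → ∀ j, j ∈ S ↔ (v.2.1 : ℤ) - v.2.2 ≤ j)

theorem RayCode.exists_codes {S : Set ℤ} (hS : ∀ j ∈ S, j + 1 ∈ S) : ∃ v : RayCode, v.Codes S := by
  have hup : ∀ i j, i ≤ j → i ∈ S → j ∈ S := fun i j hij hi => by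
    induction j, hij using Int.leInduction with
    | base => exact hi
    | succ j _ ih => exact hS _ ih
  by_cases h0 : ∃ j, j ∈ S
  · by_cases h1 : ∃ a, ∀ j ∈ S, a ≤ j
    · obtain ⟨a, ha, ha'⟩ := Int.exists_least_of_bdd (P := fun j => j ∈ S) h1 h0
      refine ⟨(none, (a.toNat, (-a).toNat)), by simp, by simp, fun _ j => ?_⟩
      rw [show ((a.toNat : ℤ) - (-a).toNat) = a by omega]
      exact ⟨ha' j, fun h => hup _ _ h ha⟩
    · push Not at h1
      refine ⟨(some true, 0), by simp, fun _ j => ?_, by simp⟩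
      obtain ⟨i, hi, hij⟩ := h1 j
      exact hup _ _ hij.le hi
  · exact ⟨(some false, 0), fun _ j hj => h0 ⟨j, hj⟩, by simp, by simp⟩

namespace FreeGroup

variable {α : Type*}

/-- The test of a code `v` for the set of the exponents `k` with `z ^ k * h ∈ R`. It consists of at
most two membership tests in `R`: the claims `∅` and `ℤ` are tested at a high positive and at a high
negative exponent, where `C` is the constant of `FinitelySplit.exists_bound`, and a ray at its end
and just below. -/
def RayCheck (R : Set (FreeGroup α)) (z : List (α × Bool)) (C : ℕ) (h : List (α × Bool))
    (v : RayCode) : Prop :=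
  (v.1 = some false → mk (zpowWord z (h.length + C, 0) ++ h) ∉ R) ∧
  (v.1 = some true → mk (zpowWord z (0, h.length + C) ++ h) ∈ R) ∧
  (v.1 = none → mk (zpowWord z v.2 ++ h) ∈ R ∧ mk (zpowWord z (v.2.1, v.2.2 + 1) ++ h) ∉ R)

theorem rayCheck_iff {R : Set (FreeGroup α)} {z : List (α × Bool)} {C : ℕ}
    (hup : ∀ g ∈ R, mk z * g ∈ R)
    (hC : ∀ h : List (α × Bool),
      ((∃ k : ℤ, mk z ^ k * mk h ∈ R) → mk z ^ (h.length + C) * mk h ∈ R) ∧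
      ((mk z)⁻¹ ^ (h.length + C) * mk h ∈ R → ∀ k : ℤ, mk z ^ k * mk h ∈ R))
    (h : List (α × Bool)) (v : RayCode) :
    RayCheck R z C h v ↔ v.Codes {k : ℤ | mk z ^ k * mk h ∈ R} := by
  have hup' : ∀ (g) (i j : ℤ), i ≤ j → mk z ^ i * g ∈ R → mk z ^ j * g ∈ R := by
    intro g i j hij hg
    induction j, hij using Int.leInduction with
    | base => exact hg
    | succ j _ ih =>
      rw [add_comm, zpow_add, zpow_one, mul_assoc]
      exact hup _ ih
  simp only [RayCheck, RayCode.Codes, ← mul_mk, mk_zpowWord, Set.mem_ofPred_eq]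
  refine and_congr ?_ (and_congr ?_ ?_) <;> refine forall_congr' fun _ => ?_
  · refine ⟨fun hk j hj => hk ?_, fun hk => hk _⟩
    have := (hC h).1 ⟨j, hj⟩
    rw [← zpow_natCast] at this
    simpa using this
  · refine ⟨fun hk => (hC h).2 ?_, fun hk => hk _⟩
    rw [inv_pow, ← zpow_natCast, ← zpow_neg]
    simpa using hk
  · constructor
    · rintro ⟨h1, h2⟩ j
      refine ⟨fun hj => ?_, fun hj => hup' _ _ _ hj h1⟩
      by_contra hlt
      exact h2 (hup' _ _ _ (by push_cast; omega) hj)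
    · intro hk
      refine ⟨(hk _).2 le_rfl, fun h2 => ?_⟩
      have := (hk _).1 h2
      push_cast at this
      omega

theorem primrecPred_rayCheck [Primcodable α] {R : Set (FreeGroup α)}
    (hR : PrimrecPred fun s : List (α × Bool) => mk s ∈ R) (z : List (α × Bool)) (C : ℕ) :
    PrimrecPred fun x : List (α × Bool) × RayCode => RayCheck R z C x.1 x.2 := by
  have hk : ∀ o : Option Bool,
      PrimrecPred fun x : List (α × Bool) × RayCode => ¬ x.2.1 = o := fun o =>
    (Primrec.eq.comp (Primrec.fst.comp Primrec.snd) (Primrec.const o)).not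
  have hw : ∀ {f : List (α × Bool) × RayCode → ℕ × ℕ}, Primrec f →
      PrimrecPred fun x => mk (zpowWord z (f x) ++ x.1) ∈ R := fun hf =>
    hR.comp (Primrec.list_append.comp (primrec_zpowWord.comp (Primrec.const z) hf) Primrec.fst)
  have hl : Primrec fun x : List (α × Bool) × RayCode => x.1.length + C :=
    Primrec.nat_add.comp (Primrec.list_length.comp Primrec.fst) (Primrec.const C)
  have ha : Primrec fun x : List (α × Bool) × RayCode => x.2.2 := Primrec.snd.comp Primrec.snd
  refine (((hk (some false)).or (hw (hl.pair (Primrec.const 0))).not).and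
    (((hk (some true)).or (hw ((Primrec.const 0).pair hl))).and
      ((hk none).or ((hw ha).and (hw ((Primrec.fst.comp ha).pair
        (Primrec.succ.comp (Primrec.snd.comp ha)))).not)))).of_eq fun x => ?_
  simp only [RayCheck, imp_iff_not_or]

theorem finitelySplit_subgroupClosure {W : Set (List (α × Bool))} (hW : W.Finite) :
    FinitelySplit (Subgroup.closure (mk '' W) : Set (FreeGroup α)) := by
  have : (Subgroup.closure (mk '' W) : Set (FreeGroup α)) =
      Submonoid.closure (mk '' (W ∪ invRev '' W)) := by
    rw [← Subgroup.coe_toSubmonoid, Subgroup.closure_toSubmonoid, Set.image_union,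
      ← Set.image_inv_eq_inv, Set.image_image, Set.image_image]
    rfl
  rw [this]
  exact FinitelySplit.closure (hW.union (hW.image _))

/-- The word that is the product of the conjugates of `w` and of its inverse described by `K`: the
entry `(d, ε)` contributes `d w d⁻¹` or `d w⁻¹ d⁻¹`. -/
def conjWord (w : List (α × Bool)) (K : List (List (α × Bool) × Bool)) : List (α × Bool) :=
  K.flatMap fun p => p.1 ++ (bif p.2 then w else invRev w) ++ invRev p.1

theorem mem_normalClosure_iff {w : List (α × Bool)} {g : FreeGroup α} :
    g ∈ Subgroup.normalClosure {mk w} ↔ ∃ K, g = mk (conjWord w K) := by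
  classical
  constructor
  · intro hg
    rw [Subgroup.normalClosure, ← Subgroup.mem_toSubmonoid, Subgroup.closure_toSubmonoid] at hg
    obtain ⟨l, hl, rfl⟩ := Submonoid.exists_list_of_mem_closure hg
    clear hg
    induction l with
    | nil => exact ⟨[], rfl⟩
    | cons x l ih =>
      simp only [List.mem_cons, forall_eq_or_imp] at hl
      obtain ⟨K, hK⟩ := ih hl.2
      have key : ∀ y ∈ Group.conjugatesOfSet {mk w}, ∃ d : List (α × Bool),
          y = mk d * mk w * (mk d)⁻¹ := by
        intro y hy
        simp only [Group.mem_conjugatesOfSet_iff, Set.mem_singleton_iff, exists_eq_left] at hy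
        obtain ⟨d, rfl⟩ := isConj_iff.1 hy
        exact ⟨d.toWord, by rw [mk_toWord]⟩
      rcases hl.1 with hx | hx
      · obtain ⟨d, rfl⟩ := key x hx
        exact ⟨(d, true) :: K, by simp [conjWord, hK, ← mul_mk, ← inv_mk, mul_assoc]⟩
      · obtain ⟨d, hd⟩ := key _ hx
        rw [inv_eq_iff_eq_inv] at hd
        exact ⟨(d, false) :: K, by simp [conjWord, hK, hd, ← mul_mk, ← inv_mk, mul_assoc]⟩
  · rintro ⟨K, rfl⟩
    induction K with
    | nil => exact one_mem _
    | cons p K ih =>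
      have hw : mk w ∈ Subgroup.normalClosure {mk w} := Subgroup.subset_normalClosure rfl
      have : mk (conjWord w (p :: K)) =
          mk p.1 * mk (bif p.2 then w else invRev w) * (mk p.1)⁻¹ * mk (conjWord w K) := by
        simp [conjWord]
      rw [this]
      refine mul_mem (Subgroup.normalClosure_normal.conj_mem _ ?_ _) ih
      cases p.2
      · exact inv_mem hw
      · exact hw

theorem primrec_conjWord [Primcodable α] (w : List (α × Bool)) : Primrec (conjWord w) := by
  have h : Primrec fun x : List (List (α × Bool) × Bool) × (List (α × Bool) × Bool) =>
      bif x.2.2 then w else invRev w :=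
    Primrec.cond (Primrec.snd.comp Primrec.snd) (Primrec.const _) (Primrec.const _)
  have h1 : Primrec fun x : List (List (α × Bool) × Bool) × (List (α × Bool) × Bool) => x.2.1 :=
    Primrec.fst.comp Primrec.snd
  exact Primrec.list_flatMap Primrec.id
    (Primrec.list_append.comp (Primrec.list_append.comp h1 h) (primrec_invRev.comp h1)).to₂

end FreeGroup

/-! ### Certified normal forms -/

theorem RayCode.codes_empty_iff {v : RayCode} : v.Codes ∅ ↔ v.1 = some false := by
  obtain ⟨_ | _ | _, a⟩ := v
  · simp only [RayCode.Codes, reduceCtorEq, Set.mem_empty_iff_false, false_iff, not_le,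
      true_implies, false_implies, true_and, iff_false, not_forall, not_lt]
    exact ⟨_, le_rfl⟩
  · simp [RayCode.Codes]
  · simp [RayCode.Codes]

namespace PinchedPresentation

open FreeGroup (mul_mk inv_mk invRev zpowWord mk_zpowWord RayCheck)

variable {X Y : Type*}

/-- An entry of a certificate: a factor, a word that represents an element of it, and a code for the
exponents that can be put in front of the sequence beginning with this element. -/
abbrev Entry (X Y : Type*) : Type _ := Bool × GWord (X ⊕ Y) × RayCode

/-- The factor of the first entry. -/
def topTag (l : List (Entry X Y)) : Option Bool := l.head?.map Prod.fst

/-- The code of the first entry, and `v₀` for the empty list. -/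
def topCode (v₀ : RayCode) (l : List (Entry X Y)) : RayCode :=
  (l.head?.map fun e => e.2.2).getD v₀

/-- The sequence of elements of the factors that a list of entries describes. -/
def syllables (l : List (Entry X Y)) : List (Bool × FreeGroup (X ⊕ Y)) :=
  l.map fun e => (e.1, FreeGroup.mk e.2.1)

variable (u : GWord X) (v : GWord Y)

/-- The product of `N b` and the cyclic group generated by the side `b` of the relation. -/
def edgeSaturation (N : Bool → Submonoid (FreeGroup (X ⊕ Y))) (b : Bool) :
    Set (FreeGroup (X ⊕ Y)) :=
  {g | ∃ r ∈ N b, ∃ s ∈ Subgroup.zpowers (FreeGroup.mk (side u v b)), r * s = g}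

/-- The test of the code `x.2.1` of a sequence with first element `x.1`, given the code `x.2.2` of
its tail. If the exponents allowed for the tail form the ray from `n` on, then `j` is allowed for
the sequence when `c ^ j * x.1 * c ^ (-n) ∈ N b`; if all exponents are allowed for the tail, the
condition is that `c ^ j * x.1` lies in `edgeSaturation`. -/
def CodeCheck (N : Bool → Submonoid (FreeGroup (X ⊕ Y))) (K₁ K₂ : Bool → ℕ) (b : Bool)
    (x : GWord (X ⊕ Y) × RayCode × RayCode) : Prop :=
  (x.2.2.1 = some false → x.2.1.1 = some false) ∧
  (x.2.2.1 = some true → RayCheck (edgeSaturation u v N b) (side u v b) (K₂ b) x.1 x.2.1) ∧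
  (x.2.2.1 = none →
    RayCheck (N b) (side u v b) (K₁ b) (x.1 ++ zpowWord (side u v b) x.2.2.2.swap) x.2.1)

/-- The test of the entry `e` in front of `l`: the factors alternate, the element lies in its factor
and not in the edge group, and the code passes its test. -/
def EntryCheck (N : Bool → Submonoid (FreeGroup (X ⊕ Y))) (K₁ K₂ : Bool → ℕ) (v₀ : RayCode)
    (e : Entry X Y) (l : List (Entry X Y)) : Prop :=
  ¬ topTag l = some e.1 ∧ FreeGroup.mk e.2.1 ∈ factor X Y e.1 ∧
    ¬ FreeGroup.mk e.2.1 ∈ Subgroup.zpowers (FreeGroup.mk (side u v e.1)) ∧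
    CodeCheck u v N K₁ K₂ e.1 (e.2.1, e.2.2, topCode v₀ l)

/-- All entries pass their tests. -/
def Valid (N : Bool → Submonoid (FreeGroup (X ⊕ Y))) (K₁ K₂ : Bool → ℕ) (v₀ : RayCode) :
    List (Entry X Y) → Prop
  | [] => True
  | e :: l => EntryCheck u v N K₁ K₂ v₀ e l ∧ Valid N K₁ K₂ v₀ l

variable {u v}

theorem primrecPred_bool_prod {α : Type*} [Primcodable α] {p : Bool → α → Prop}
    (hp : ∀ b, PrimrecPred (p b)) : PrimrecPred fun x : Bool × α => p x.1 x.2 := by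
  have h : ∀ b, PrimrecPred fun x : Bool × α => x.1 = b ∧ p b x.2 := fun b =>
    (Primrec.eq.comp Primrec.fst (Primrec.const b)).and ((hp b).comp Primrec.snd)
  refine ((h true).or (h false)).of_eq fun x => ?_
  obtain ⟨_ | _, x⟩ := x <;> simp

theorem finitelySplit_zpowers (b : Bool) : FreeGroup.FinitelySplit
    (Subgroup.zpowers (FreeGroup.mk (side u v b)) : Set (FreeGroup (X ⊕ Y))) := by
  have := FreeGroup.finitelySplit_subgroupClosure (W := {side u v b}) (Set.toFinite _)
  rwa [Set.image_singleton, ← Subgroup.zpowers_eq_closure] at this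

section Primrec

section

variable [Finite X] [Finite Y]

theorem finitelySplit_factor (b : Bool) :
    FreeGroup.FinitelySplit (factor X Y b : Set (FreeGroup (X ⊕ Y))) := by
  have := FreeGroup.finitelySplit_subgroupClosure
    (W := (fun z => [(z, true)]) '' {z : X ⊕ Y | z.isLeft = b}) (Set.toFinite _)
  rw [Set.image_image] at this
  exact this

end

variable {N : Bool → Submonoid (FreeGroup (X ⊕ Y))}

theorem finitelySplit_edgeSaturation
    (hN : ∀ b, FreeGroup.FinitelySplit (N b : Set (FreeGroup (X ⊕ Y)))) (b : Bool) :
    FreeGroup.FinitelySplit (edgeSaturation u v N b) :=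
  (hN b).mul (finitelySplit_zpowers b)

variable [Primcodable X] [Primcodable Y]

theorem primrec_topTag : Primrec (topTag : List (Entry X Y) → Option Bool) :=
  Primrec.option_map Primrec.list_head? (Primrec.fst.comp Primrec.snd).to₂

theorem primrec_topCode (v₀ : RayCode) : Primrec (topCode v₀ : List (Entry X Y) → RayCode) :=
  Primrec.option_getD.comp (Primrec.option_map Primrec.list_head?
    (Primrec.snd.comp (Primrec.snd.comp Primrec.snd)).to₂) (Primrec.const v₀)

variable [Finite X] [Finite Y]

theorem primrecPred_codeCheck
    (hN : ∀ b, FreeGroup.FinitelySplit (N b : Set (FreeGroup (X ⊕ Y)))) (K₁ K₂ : Bool → ℕ)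
    (b : Bool) : PrimrecPred (CodeCheck u v N K₁ K₂ b) := by
  have hc : Primrec fun x : GWord (X ⊕ Y) × RayCode × RayCode => x.2.1 :=
    Primrec.fst.comp Primrec.snd
  have hc' : Primrec fun x : GWord (X ⊕ Y) × RayCode × RayCode => x.2.2 :=
    Primrec.snd.comp Primrec.snd
  have hk : ∀ o : Option Bool,
      PrimrecPred fun x : GWord (X ⊕ Y) × RayCode × RayCode => ¬ x.2.2.1 = o := fun o =>
    (Primrec.eq.comp (Primrec.fst.comp hc') (Primrec.const o)).not
  have h1 := (hk (some false)).or
    (Primrec.eq.comp (Primrec.fst.comp hc) (Primrec.const (some false)))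
  have h2 := (hk (some true)).or ((FreeGroup.primrecPred_rayCheck
    (finitelySplit_edgeSaturation (u := u) (v := v) hN b).primrecPred (side u v b) (K₂ b)).comp
    (Primrec.fst.pair hc))
  have h3 := (hk none).or ((FreeGroup.primrecPred_rayCheck
    (hN b).primrecPred (side u v b) (K₁ b)).comp
    ((Primrec.list_append.comp Primrec.fst (FreeGroup.primrec_zpowWord.comp
      (Primrec.const (side u v b)) (((Primrec.snd.comp (Primrec.snd.comp hc')).pair
        (Primrec.fst.comp (Primrec.snd.comp hc')))))).pair hc))
  refine (h1.and (h2.and h3)).of_eq fun x => ?_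
  simp only [CodeCheck, imp_iff_not_or]
  rfl

theorem primrecPred_valid
    (hN : ∀ b, FreeGroup.FinitelySplit (N b : Set (FreeGroup (X ⊕ Y)))) (K₁ K₂ : Bool → ℕ)
    (v₀ : RayCode) : PrimrecPred (Valid u v N K₁ K₂ v₀) := by
  classical
  have he : PrimrecPred fun x : Entry X Y × List (Entry X Y) =>
      EntryCheck u v N K₁ K₂ v₀ x.1 x.2 := by
    have ht : Primrec fun x : Entry X Y × List (Entry X Y) => x.1.1 := Primrec.fst.comp Primrec.fst
    have hg : Primrec fun x : Entry X Y × List (Entry X Y) => x.1.2.1 :=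
      Primrec.fst.comp (Primrec.snd.comp Primrec.fst)
    have hv : Primrec fun x : Entry X Y × List (Entry X Y) => x.1.2.2 :=
      Primrec.snd.comp (Primrec.snd.comp Primrec.fst)
    have hl : Primrec fun x : Entry X Y × List (Entry X Y) => x.2 := Primrec.snd
    have h1 : PrimrecPred fun x : Entry X Y × List (Entry X Y) => topTag x.2 = some x.1.1 :=
      Primrec.eq.comp (primrec_topTag.comp hl) (Primrec.option_some.comp ht)
    have h2 : PrimrecPred fun x : Bool × GWord (X ⊕ Y) => FreeGroup.mk x.2 ∈ factor X Y x.1 :=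
      primrecPred_bool_prod (p := fun b s => FreeGroup.mk s ∈ factor X Y b) fun b =>
        (finitelySplit_factor b).primrecPred
    have h3 : PrimrecPred fun x : Bool × GWord (X ⊕ Y) =>
        FreeGroup.mk x.2 ∈ Subgroup.zpowers (FreeGroup.mk (side u v x.1)) :=
      primrecPred_bool_prod
        (p := fun b s => FreeGroup.mk s ∈ Subgroup.zpowers (FreeGroup.mk (side u v b))) fun b =>
        (finitelySplit_zpowers b).primrecPred
    have h4 : PrimrecPred fun x : Bool × (GWord (X ⊕ Y) × RayCode × RayCode) =>
        CodeCheck u v N K₁ K₂ x.1 x.2 :=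
      primrecPred_bool_prod (p := CodeCheck u v N K₁ K₂) (primrecPred_codeCheck hN K₁ K₂)
    have h2' := h2.comp (ht.pair hg)
    have h3' := h3.comp (ht.pair hg)
    have h4' := h4.comp (ht.pair (hg.pair (hv.pair ((primrec_topCode v₀).comp hl))))
    exact h1.not.and (h2'.and (h3'.not.and h4'))
  have hrec := Primrec.list_rec (f := fun l : List (Entry X Y) => l) (g := fun _ => true)
    (h := fun _ x => decide (EntryCheck u v N K₁ K₂ v₀ x.1 x.2.1) && x.2.2) Primrec.id
    (Primrec.const true) (Primrec.and.comp (he.decide.comp ((Primrec.fst.comp Primrec.snd).pair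
      (Primrec.fst.comp (Primrec.snd.comp Primrec.snd))))
      (Primrec.snd.comp (Primrec.snd.comp Primrec.snd))).to₂
  refine Primrec.primrecPred (hrec.of_eq fun l => ?_)
  rw [Bool.eq_iff_iff, decide_eq_true_iff]
  induction l with
  | nil => simp [Valid]
  | cons e l ih => simp only [Valid, ← ih, Bool.and_eq_true, decide_eq_true_iff]

end Primrec

section Correct

variable (A : CyclicAmalgam (FreeGroup (X ⊕ Y)) (OneRelGroup (pinchedRelator u v)))
  (hAH : A.H = factor X Y) (hAc : A.c = fun b => FreeGroup.mk (side u v b))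
  {N : Bool → Submonoid (FreeGroup (X ⊕ Y))} (hNH : ∀ b, ∀ x ∈ N b, x ∈ A.H b)
  (hcN : ∀ b, A.c b ∈ N b)
  (hN : ∀ (b b' : Bool) (k : ℤ), A.c b ^ k ∈ N b → A.c b' ^ k ∈ N b')
  {K₁ K₂ : Bool → ℕ}
  (hK₁ : ∀ b (h : GWord (X ⊕ Y)) (w : RayCode), RayCheck (N b) (side u v b) (K₁ b) h w ↔
    w.Codes {k : ℤ | FreeGroup.mk (side u v b) ^ k * FreeGroup.mk h ∈ N b})
  (hK₂ : ∀ b (h : GWord (X ⊕ Y)) (w : RayCode),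
    RayCheck (edgeSaturation u v N b) (side u v b) (K₂ b) h w ↔
    w.Codes {k : ℤ | FreeGroup.mk (side u v b) ^ k * FreeGroup.mk h ∈ edgeSaturation u v N b})

/-- The set of the exponents `j` for which `t ^ j` times the value of `l` lies in the submonoid
generated by the images of the `N b`. -/
def exponents (N : Bool → Submonoid (FreeGroup (X ⊕ Y))) (l : List (Bool × FreeGroup (X ⊕ Y))) :
    Set ℤ := {j | A.t ^ j * A.val l ∈ A.span N}

include hAc hNH hcN hN hK₁ hK₂ in
/-- If the code of the tail is correct, the test decides whether the code of the sequence is. -/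
theorem codeCheck_iff {b : Bool} {g : GWord (X ⊕ Y)} {l : List (Bool × FreeGroup (X ⊕ Y))}
    (hl : IsReducedSeq A.H A.c ((b, FreeGroup.mk g) :: l)) {w w' : RayCode}
    (hw' : w'.Codes (exponents A N l)) :
    CodeCheck u v N K₁ K₂ b (g, w, w') ↔
      w.Codes (exponents A N ((b, FreeGroup.mk g) :: l)) := by
  have hS : exponents A N ((b, FreeGroup.mk g) :: l) = {j | ∃ i : ℤ, i ∈ exponents A N l ∧
      A.c b ^ j * FreeGroup.mk g * A.c b ^ (-i) ∈ N b} :=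
    Set.ext fun j => A.val_cons_mem_span_iff hNH hN hl j
  have hcb : A.c b = FreeGroup.mk (side u v b) := congrFun hAc b
  obtain ⟨h1, h2, h3⟩ := hw'
  obtain ⟨_ | _ | _, a⟩ := w'
  · simp only [true_implies] at h3
    have : exponents A N ((b, FreeGroup.mk g) :: l) = {k : ℤ | FreeGroup.mk (side u v b) ^ k *
        FreeGroup.mk (g ++ zpowWord (side u v b) a.swap) ∈ N b} := by
      rw [hS]
      ext j
      simp only [Set.mem_ofPred_eq, ← mul_mk, mk_zpowWord, ← hcb, Prod.fst_swap, Prod.snd_swap,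
        ← mul_assoc]
      constructor
      · rintro ⟨i, hi, hiN⟩
        rw [h3] at hi
        obtain ⟨n, hn⟩ := Int.eq_ofNat_of_zero_le (sub_nonneg.2 hi)
        have := mul_mem hiN (pow_mem (hcN b) n)
        rwa [mul_assoc _ _ (_ ^ n), ← zpow_natCast, ← hn, ← zpow_add,
          show -i + (i - ((a.1 : ℤ) - a.2)) = a.2 - a.1 by ring] at this
      · intro h
        refine ⟨a.1 - a.2, (h3 _).2 le_rfl, ?_⟩
        rwa [neg_sub]
    simp only [CodeCheck, reduceCtorEq, false_implies, true_implies, true_and, this, hK₁]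
  · simp only [true_implies] at h1
    have : exponents A N ((b, FreeGroup.mk g) :: l) = ∅ := by
      rw [hS]
      ext j
      simp [h1]
    simp [CodeCheck, this, RayCode.codes_empty_iff]
  · simp only [true_implies] at h2
    have : exponents A N ((b, FreeGroup.mk g) :: l) = {k : ℤ | FreeGroup.mk (side u v b) ^ k *
        FreeGroup.mk g ∈ edgeSaturation u v N b} := by
      rw [hS]
      ext j
      simp only [Set.mem_ofPred_eq, ← hcb, h2, true_and, edgeSaturation]
      constructor
      · rintro ⟨i, hi⟩
        exact ⟨_, hi, A.c b ^ i, ⟨i, rfl⟩, by group⟩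
      · rintro ⟨r, hr, _, ⟨i, rfl⟩, h⟩
        refine ⟨i, ?_⟩
        rw [← h]
        simpa using hr
    simp [CodeCheck, this, hK₂]

variable {v₀ : RayCode} (hv₀ : v₀.Codes (exponents A N []))

theorem syllables_head (l : List (Entry X Y)) (b : Bool) :
    (∀ x ∈ (syllables l).head?, b ≠ x.1) ↔ ¬ topTag l = some b := by
  cases l with
  | nil => simp [syllables, topTag]
  | cons e l => simp [syllables, topTag, eq_comm]

include hAH hAc hNH hcN hN hK₁ hK₂ hv₀ in
/-- A list that passes the tests is a normal form, and its first code is correct. -/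
theorem Valid.sound {l : List (Entry X Y)} (hl : Valid u v N K₁ K₂ v₀ l) :
    IsReducedSeq A.H A.c (syllables l) ∧ (topCode v₀ l).Codes (exponents A N (syllables l)) := by
  induction l with
  | nil => exact ⟨.nil, hv₀⟩
  | cons e l ih =>
    obtain ⟨⟨h1, h2, h3, h4⟩, h5⟩ := hl
    obtain ⟨h6, h7⟩ := ih h5
    have h8 : IsReducedSeq A.H A.c (syllables (e :: l)) := by
      refine h6.cons ((syllables_head l e.1).2 h1) (by rwa [hAH]) (by rwa [hAc])
    exact ⟨h8, (codeCheck_iff A hAc hNH hcN hN hK₁ hK₂ h8 h7).1 h4⟩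

include hAH hAc hNH hcN hN hK₁ hK₂ hv₀ in
/-- Every normal form can be supplied with codes that pass the tests. -/
theorem exists_valid {m : List (Bool × FreeGroup (X ⊕ Y))} (hm : IsReducedSeq A.H A.c m) :
    ∃ l : List (Entry X Y), Valid u v N K₁ K₂ v₀ l ∧ syllables l = m := by
  induction m with
  | nil => exact ⟨[], trivial, rfl⟩
  | cons x m ih =>
    obtain ⟨b, g⟩ := x
    obtain ⟨h1, h2, h3, h4⟩ := IsReducedSeq.cons_iff.1 hm
    obtain ⟨l, hl, rfl⟩ := ih h1
    obtain ⟨g, rfl⟩ := Quot.exists_rep g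
    have hup : ∀ j ∈ exponents A N ((b, FreeGroup.mk g) :: syllables l),
        j + 1 ∈ exponents A N ((b, FreeGroup.mk g) :: syllables l) := by
      intro j hj
      have h := A.mem_span (hcN b)
      rw [A.map_c] at h
      have := mul_mem h hj
      rwa [← mul_assoc, ← zpow_one_add, add_comm] at this
    obtain ⟨w, hw⟩ := RayCode.exists_codes hup
    refine ⟨(b, g, w) :: l, ⟨⟨(syllables_head l b).1 h2, by rwa [hAH] at h3, by rwa [hAc] at h4,
      ?_⟩, hl⟩, rfl⟩
    exact (codeCheck_iff A hAc hNH hcN hN hK₁ hK₂ hm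
      (hl.sound A hAH hAc hNH hcN hN hK₁ hK₂ hv₀).2).2 hw

end Correct

end PinchedPresentation

/-! ### Decidability of prefix membership -/

namespace PinchedPresentation

open FreeGroup (mul_mk zpowWord mk_zpowWord conjWord)
open OneRelGroup (ofWord_append)

variable {X Y : Type*} {u : GWord X} {v : GWord Y} (hu : u ≠ []) (hv : v ≠ [])
  (hur : FreeGroup.IsReduced u) (hvr : FreeGroup.IsReduced v)

theorem exists_reducedSeq (s : GWord (X ⊕ Y)) : ∃ (k : ℤ) (l : List (Bool × FreeGroup (X ⊕ Y))),
    IsReducedSeq (amalgam u v hu hv hur hvr).H (amalgam u v hu hv hur hvr).c l ∧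
    OneRelGroup.ofWord (pinchedRelator u v) s =
      (amalgam u v hu hv hur hvr).t ^ k * (amalgam u v hu hv hur hvr).val l := by
  set A := amalgam u v hu hv hur hvr
  have hs : OneRelGroup.ofWord (pinchedRelator u v) s ∈ A.span fun b => (A.H b).toSubmonoid := by
    induction s with
    | nil => exact one_mem _
    | cons x s ih =>
      rw [← List.singleton_append, ofWord_append]
      exact mul_mem (A.mem_span (N := fun b => (A.H b).toSubmonoid)
        (mk_mem_factor (b := x.1.isLeft) (by simp))) ih
  obtain ⟨k, l, h1, -, -, h2⟩ := A.exists_form (N := fun b => (A.H b).toSubmonoid)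
    (fun b x hx => hx) (fun b b' k _ => zpow_mem (A.c_mem b') k) hs
  exact ⟨k, l, h1, h2⟩

/-- A certificate for a word: the exponent of `t`, the list of entries of a normal form, and the
conjugates of the relator that prove that the normal form represents the same element. -/
abbrev Certificate (X Y : Type*) : Type _ :=
  (ℕ × ℕ) × List (Entry X Y) × List (GWord (X ⊕ Y) × Bool)

/-- The word that a certificate describes. It has to be equal in the free group to the word that is
certified. -/
def Certificate.word (u : GWord X) (v : GWord Y) (c : Certificate X Y) : GWord (X ⊕ Y) :=
  conjWord (pinchedRelator u v) c.2.2 ++ zpowWord (side u v true) c.1 ++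
    c.2.1.flatMap fun e => e.2.1

theorem primrec_certificate_word [Primcodable X] [Primcodable Y] :
    Primrec (Certificate.word u v) :=
  Primrec.list_append.comp (Primrec.list_append.comp
    ((FreeGroup.primrec_conjWord _).comp (Primrec.snd.comp Primrec.snd))
    (FreeGroup.primrec_zpowWord.comp (Primrec.const _) Primrec.fst))
    (Primrec.list_flatMap (Primrec.fst.comp Primrec.snd)
      (Primrec.fst.comp (Primrec.snd.comp Primrec.snd)).to₂)

theorem map_conjWord (K : List (GWord (X ⊕ Y) × Bool)) :
    PresentedGroup.mk {FreeGroup.mk (pinchedRelator u v)}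
      (FreeGroup.mk (conjWord (pinchedRelator u v) K)) = 1 :=
  (QuotientGroup.eq_one_iff _).2 (FreeGroup.mem_normalClosure_iff.2 ⟨K, rfl⟩)

theorem map_flatMap (l : List (Entry X Y)) :
    (amalgam u v hu hv hur hvr).φ (FreeGroup.mk (l.flatMap fun e => e.2.1)) =
      (amalgam u v hu hv hur hvr).val (syllables l) := by
  induction l with
  | nil => exact (map_one _).trans (CyclicAmalgam.val_nil _).symm
  | cons e l ih =>
    rw [List.flatMap_cons, ← mul_mk, map_mul, ih]
    exact (CyclicAmalgam.val_cons _ _ _ _).symm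

theorem map_certificate_word (c : Certificate X Y) :
    (amalgam u v hu hv hur hvr).φ (FreeGroup.mk (c.word u v)) =
      (amalgam u v hu hv hur hvr).t ^ ((c.1.1 : ℤ) - c.1.2) *
        (amalgam u v hu hv hur hvr).val (syllables c.2.1) := by
  rw [Certificate.word, ← mul_mk, ← mul_mk, map_mul, map_mul, map_flatMap hu hv hur hvr,
    mk_zpowWord, map_zpow, ← (amalgam u v hu hv hur hvr).map_c true]
  have : (amalgam u v hu hv hur hvr).φ
    (FreeGroup.mk (conjWord (pinchedRelator u v) c.2.2)) = 1 := map_conjWord c.2.2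
  rw [this, one_mul]
  rfl

theorem mul_mem_edgeSaturation {N : Bool → Submonoid (FreeGroup (X ⊕ Y))} {b : Bool}
    {x g : FreeGroup (X ⊕ Y)} (hx : x ∈ N b) (hg : g ∈ edgeSaturation u v N b) :
    x * g ∈ edgeSaturation u v N b := by
  obtain ⟨r, hr, s, hs, rfl⟩ := hg
  exact ⟨x * r, mul_mem hx hr, s, hs, mul_assoc _ _ _⟩

/-- The exponent `x.1.1 - x.1.2` belongs to the set that has the code `x.2`. -/
def MemTest (x : (ℕ × ℕ) × RayCode) : Prop :=
  x.2.1 = some true ∨ (x.2.1 = none ∧ x.2.2.1 + x.1.2 ≤ x.1.1 + x.2.2.2)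

theorem primrecPred_memTest : PrimrecPred MemTest := by
  have hk : ∀ o : Option Bool, PrimrecPred fun x : (ℕ × ℕ) × RayCode => x.2.1 = o := fun o =>
    Primrec.eq.comp (Primrec.fst.comp Primrec.snd) (Primrec.const o)
  have ha : Primrec fun x : (ℕ × ℕ) × RayCode => x.2.2 := Primrec.snd.comp Primrec.snd
  have hk' : Primrec fun x : (ℕ × ℕ) × RayCode => x.1 := Primrec.fst
  exact (hk (some true)).or ((hk none).and (Primrec.nat_le.comp
    (Primrec.nat_add.comp (Primrec.fst.comp ha) (Primrec.snd.comp hk'))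
    (Primrec.nat_add.comp (Primrec.fst.comp hk') (Primrec.snd.comp ha))))

theorem memTest_iff {k : ℕ × ℕ} {w : RayCode} {S : Set ℤ} (h : w.Codes S) :
    MemTest (k, w) ↔ (k.1 : ℤ) - k.2 ∈ S := by
  obtain ⟨h1, h2, h3⟩ := h
  obtain ⟨_ | _ | _, a⟩ := w
  · simp only [true_implies] at h3
    simp only [MemTest, h3, reduceCtorEq, true_and, false_or]
    omega
  · simp [MemTest, h1]
  · simp [MemTest, h2]

include hu hv hur hvr in
/-- Every word has a certificate, certificates are recognizable, and a certificate tells whether the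
word represents an element of the prefix monoid and whether it represents `1`. The constants in the
procedure, `v₀` (the code for the empty sequence) and the pumping bounds, depend on `u` and `v`
only. -/
theorem exists_decision [Finite X] [Finite Y] [Primcodable X] [Primcodable Y] :
    ∃ (r : GWord (X ⊕ Y) × Certificate X Y → Prop) (v₀ : RayCode), ComputablePred r ∧
      (∀ s, ∃ c, r (s, c)) ∧ ∀ s c, r (s, c) →
        (OneRelGroup.ofWord (pinchedRelator u v) s ∈ prefixMonoid (pinchedRelator u v) ↔
          MemTest (c.1, topCode v₀ c.2.1)) ∧
        (OneRelGroup.ofWord (pinchedRelator u v) s = 1 ↔ c.2.1 = [] ∧ c.1.1 = c.1.2) := by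
  obtain ⟨W, hWfin, hWside, hWmem, hWN, hspan⟩ := exists_generators hu hv hur hvr
  set A := amalgam u v hu hv hur hvr with hA
  set N : Bool → Submonoid (FreeGroup (X ⊕ Y)) := fun b =>
    Submonoid.closure (FreeGroup.mk '' W b) with hNdef
  have hNs : ∀ b, FreeGroup.FinitelySplit (N b : Set (FreeGroup (X ⊕ Y))) := fun b =>
    FreeGroup.FinitelySplit.closure (hWfin b)
  have hcN : ∀ b, A.c b ∈ N b := fun b => Submonoid.subset_closure ⟨_, hWside b, rfl⟩
  have hNH : ∀ b, ∀ x ∈ N b, x ∈ A.H b := fun b x hx => by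
    have : N b ≤ (factor X Y b).toSubmonoid := by
      refine Submonoid.closure_le.2 ?_
      rintro _ ⟨s, hs, rfl⟩
      exact mk_mem_factor (hWmem b s hs)
    exact this hx
  have hred := isReduced_side hur hvr
  have hne := side_ne_nil hu hv
  choose K₁ hK₁ using fun b => (hNs b).exists_bound (hred b) (hne b)
    fun g hg => mul_mem (hcN b) hg
  choose K₂ hK₂ using fun b => (finitelySplit_edgeSaturation (u := u) (v := v) hNs b).exists_bound
    (hred b) (hne b) fun g hg => mul_mem_edgeSaturation (hcN b) hg
  have hK₁' := fun b => FreeGroup.rayCheck_iff (fun g hg => mul_mem (hcN b) hg) (hK₁ b)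
  have hK₂' := fun b => FreeGroup.rayCheck_iff
    (fun g hg => mul_mem_edgeSaturation (hcN b) hg) (hK₂ b)
  obtain ⟨v₀, hv₀⟩ : ∃ v₀ : RayCode, v₀.Codes (exponents A N []) := by
    refine RayCode.exists_codes fun j hj => ?_
    have h := A.mem_span (hcN true)
    rw [A.map_c] at h
    have := mul_mem h hj
    rwa [← mul_assoc, ← zpow_one_add, add_comm] at this
  refine ⟨fun x => Valid u v N K₁ K₂ v₀ x.2.2.1 ∧ FreeGroup.mk x.1 =
    FreeGroup.mk (x.2.word u v), v₀, ?_, ?_, ?_⟩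
  · exact (((primrecPred_valid hNs K₁ K₂ v₀).comp
      (Primrec.fst.comp (Primrec.snd.comp Primrec.snd))).and (FreeGroup.primrecRel_mk_eq.comp
        Primrec.fst (primrec_certificate_word.comp Primrec.snd))).computablePred
  · intro s
    obtain ⟨k, m, hm, hs⟩ := exists_reducedSeq hu hv hur hvr s
    obtain ⟨l, hl, rfl⟩ := exists_valid A rfl rfl hNH hcN hWN hK₁' hK₂' hv₀ hm
    have h1 := map_certificate_word hu hv hur hvr ((k.toNat, (-k).toNat), l, [])
    simp only [show ((k.toNat : ℤ) - (-k).toNat) = k by omega] at h1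
    have h2 : A.φ (FreeGroup.mk s) =
        A.φ (FreeGroup.mk (Certificate.word u v ((k.toNat, (-k).toNat), l, []))) := hs.trans h1.symm
    rw [← mul_inv_eq_one, ← map_inv, ← map_mul] at h2
    obtain ⟨K, hK⟩ := FreeGroup.mem_normalClosure_iff.1 ((QuotientGroup.eq_one_iff _).1 h2)
    refine ⟨((k.toNat, (-k).toNat), l, K), hl, ?_⟩
    rw [mul_inv_eq_iff_eq_mul] at hK
    rw [hK]
    simp [Certificate.word, conjWord]
  · rintro s c ⟨hl, hs⟩
    obtain ⟨h1, h2⟩ := hl.sound A rfl rfl hNH hcN hWN hK₁' hK₂' hv₀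
    have h3 : OneRelGroup.ofWord (pinchedRelator u v) s =
        A.t ^ ((c.1.1 : ℤ) - c.1.2) * A.val (syllables c.2.1) := by
      rw [OneRelGroup.ofWord, hs]
      exact map_certificate_word hu hv hur hvr c
    refine ⟨?_, ?_⟩
    · rw [memTest_iff h2, h3, ← hspan]
      rfl
    · rw [h3]
      constructor
      · intro h
        have h4 : syllables c.2.1 = [] := A.eq_nil_of_val_eq h1 (k := -((c.1.1 : ℤ) - c.1.2))
          (by rw [zpow_neg]; exact (inv_eq_of_mul_eq_one_right h).symm)
        rw [h4, CyclicAmalgam.val_nil, mul_one] at h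
        have := A.zpow_ne_one _ h
        exact ⟨by simpa [syllables] using h4, by omega⟩
      · rintro ⟨h4, h5⟩
        simp [h4, h5, syllables]

variable [Finite X] [Finite Y] [Primcodable X] [Primcodable Y]

include hu hv hur hvr in
theorem decidablePrefixMembership : DecidablePrefixMembership (pinchedRelator u v) := by
  obtain ⟨r, v₀, hr, hex, h⟩ := exists_decision hu hv hur hvr
  refine ComputablePred.of_certificate hr (q := fun x => MemTest (x.2.1, topCode v₀ x.2.2.1)) ?_ hex
    fun s c hc => (h s c hc).1
  exact (primrecPred_memTest.comp ((Primrec.fst.comp Primrec.snd).pair ((primrec_topCode v₀).comp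
    (Primrec.fst.comp (Primrec.snd.comp Primrec.snd))))).computablePred

include hu hv hur hvr in
theorem computablePred_ofWord_eq_one :
    ComputablePred fun s => OneRelGroup.ofWord (pinchedRelator u v) s = 1 := by
  obtain ⟨r, v₀, hr, hex, h⟩ := exists_decision hu hv hur hvr
  refine ComputablePred.of_certificate hr
    (q := fun x => x.2.2.1 = [] ∧ x.2.1.1 = x.2.1.2) ?_ hex fun s c hc => (h s c hc).2
  exact ((Primrec.eq.comp (Primrec.fst.comp (Primrec.snd.comp Primrec.snd)) (Primrec.const [])).and
    (Primrec.eq.comp (Primrec.fst.comp (Primrec.fst.comp Primrec.snd))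
      (Primrec.snd.comp (Primrec.fst.comp Primrec.snd)))).computablePred

end PinchedPresentation

/-! ### Inverse monoids -/

/-- An inverse monoid: a monoid with an involution that makes it a regular `*`-semigroup whose
idempotents `a * a⁻¹` commute. -/
class InverseMonoid (M : Type*) extends Monoid M, InvolutiveInv M where
  mul_inv_rev' : ∀ a b : M, (a * b)⁻¹ = b⁻¹ * a⁻¹
  mul_inv_mul' : ∀ a : M, a * a⁻¹ * a = a
  mul_inv_comm' : ∀ a b : M, a * a⁻¹ * (b * b⁻¹) = b * b⁻¹ * (a * a⁻¹)

namespace InverseMonoid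

variable {M : Type*} [InverseMonoid M]

theorem inv_mul_rev (a b : M) : (a * b)⁻¹ = b⁻¹ * a⁻¹ := mul_inv_rev' a b

theorem mul_inv_mul (a : M) : a * a⁻¹ * a = a := mul_inv_mul' a

theorem inv_mul_mul (a : M) : a * (a⁻¹ * a) = a := by rw [← mul_assoc, mul_inv_mul]

theorem mul_inv_comm (a b : M) : a * a⁻¹ * (b * b⁻¹) = b * b⁻¹ * (a * a⁻¹) := mul_inv_comm' a b

theorem mul_inv_mul_self (a : M) : a * a⁻¹ * (a * a⁻¹) = a * a⁻¹ := by
  rw [← mul_assoc, mul_inv_mul]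

theorem inv_one' : (1 : M)⁻¹ = 1 := by
  have := mul_inv_mul (1 : M)
  rwa [one_mul, mul_one] at this

/-- The natural partial order: `a ≤ b` if `a` is the restriction of `b` to the domain of `a`. -/
instance : LE M := ⟨fun a b => a * a⁻¹ * b = a⟩

theorem le_def {a b : M} : a ≤ b ↔ a * a⁻¹ * b = a := Iff.rfl

theorem le_iff_exists {a b : M} : a ≤ b ↔ ∃ c, a = c * c⁻¹ * b := by
  refine ⟨fun h => ⟨a, h.symm⟩, ?_⟩
  rintro ⟨c, rfl⟩
  rw [le_def, inv_mul_rev, inv_mul_rev, inv_inv,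
    show c * c⁻¹ * b * (b⁻¹ * (c * c⁻¹)) * b = c * c⁻¹ * (b * b⁻¹ * (c * c⁻¹)) * b by
      simp only [mul_assoc], mul_inv_comm b c, ← mul_assoc, mul_inv_mul_self,
    mul_assoc (c * c⁻¹), mul_inv_mul]

theorem le_iff_exists_right {a b : M} : a ≤ b ↔ ∃ c, a = b * (c * c⁻¹) := by
  rw [le_iff_exists]
  constructor
  · rintro ⟨c, rfl⟩
    refine ⟨b⁻¹ * c, ?_⟩
    have h := mul_inv_comm b c
    rw [inv_mul_rev, inv_inv,
      show b * (b⁻¹ * c * (c⁻¹ * b)) = b * b⁻¹ * (c * c⁻¹) * b by simp only [mul_assoc], h,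
      mul_assoc (c * c⁻¹), mul_inv_mul]
  · rintro ⟨c, rfl⟩
    refine ⟨b * c, ?_⟩
    have h := mul_inv_comm c b⁻¹
    rw [inv_inv] at h
    rw [inv_mul_rev, show b * c * (c⁻¹ * b⁻¹) * b = b * (c * c⁻¹ * (b⁻¹ * b)) by
      simp only [mul_assoc], h, ← mul_assoc b (b⁻¹ * b), inv_mul_mul]

protected theorem le_refl (a : M) : a ≤ a := mul_inv_mul a

instance : PartialOrder M where
  le_refl := InverseMonoid.le_refl
  le_trans a b c hab hbc := by
    obtain ⟨x, rfl⟩ := le_iff_exists.1 hab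
    obtain ⟨y, rfl⟩ := le_iff_exists.1 hbc
    refine le_iff_exists.2 ⟨x * x⁻¹ * (y * y⁻¹), ?_⟩
    rw [inv_mul_rev, inv_mul_rev, inv_mul_rev, inv_inv, inv_inv,
      show x * x⁻¹ * (y * y⁻¹) * (y * y⁻¹ * (x * x⁻¹)) =
        x * x⁻¹ * (y * y⁻¹ * (y * y⁻¹)) * (x * x⁻¹) by simp only [mul_assoc], mul_inv_mul_self,
      mul_inv_comm x y, mul_assoc (y * y⁻¹), mul_inv_mul_self, ← mul_inv_comm x y]
    simp only [mul_assoc]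
  le_antisymm a b hab hba := by
    rw [le_def] at hab hba
    calc a = a * a⁻¹ * b := hab.symm
      _ = a * a⁻¹ * (b * b⁻¹) * a := by rw [mul_assoc (a * a⁻¹), hba]
      _ = b * b⁻¹ * a := by rw [mul_inv_comm, mul_assoc, mul_inv_mul]
      _ = b := hba

theorem inv_le_inv' {a b : M} (h : a ≤ b) : a⁻¹ ≤ b⁻¹ := by
  obtain ⟨c, rfl⟩ := le_iff_exists.1 h
  refine le_iff_exists_right.2 ⟨c, ?_⟩
  rw [inv_mul_rev, inv_mul_rev, inv_inv]

theorem mul_le_mul'' {a b c d : M} (h : a ≤ b) (h' : c ≤ d) : a * c ≤ b * d := by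
  have h1 : a * c ≤ b * c := by
    obtain ⟨x, rfl⟩ := le_iff_exists.1 h
    exact le_iff_exists.2 ⟨x, mul_assoc _ _ _⟩
  refine h1.trans ?_
  obtain ⟨x, rfl⟩ := le_iff_exists_right.1 h'
  exact le_iff_exists_right.2 ⟨x, (mul_assoc _ _ _).symm⟩

theorem mul_inv_le_one (a : M) : a * a⁻¹ ≤ 1 := le_iff_exists.2 ⟨a, (mul_one _).symm⟩

/-- Right units are maximal in the natural order. -/
theorem eq_of_le_of_mul_inv_eq_one {a b : M} (h : a ≤ b) (ha : a * a⁻¹ = 1) : a = b := by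
  rw [le_def, ha, one_mul] at h
  exact h.symm

/-- The idempotent of a product lies below the idempotent of its left factor. -/
theorem mul_inv_mul_le (a b : M) : a * b * (a * b)⁻¹ ≤ a * a⁻¹ := by
  rw [inv_mul_rev, show a * b * (b⁻¹ * a⁻¹) = a * (b * b⁻¹) * a⁻¹ by simp only [mul_assoc]]
  have := mul_le_mul'' (mul_le_mul'' (le_refl a) (mul_inv_le_one b)) (le_refl a⁻¹)
  rwa [mul_one] at this

theorem mul_inv_eq_one_of_mul {a b : M} (h : a * b * (a * b)⁻¹ = 1) : a * a⁻¹ = 1 :=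
  le_antisymm (mul_inv_le_one a) (h ▸ mul_inv_mul_le a b)

theorem mul_mul_inv_eq_one {a b : M} (ha : a * a⁻¹ = 1) (hb : b * b⁻¹ = 1) :
    a * b * (a * b)⁻¹ = 1 := by
  rw [inv_mul_rev, show a * b * (b⁻¹ * a⁻¹) = a * (b * b⁻¹) * a⁻¹ by simp only [mul_assoc], hb,
    mul_one, ha]

theorem mul_inv_le_mul_inv_iff {e a : M} : e * e⁻¹ ≤ a * a⁻¹ ↔ e * e⁻¹ * (a * a⁻¹) = e * e⁻¹ := by
  rw [le_def, inv_mul_rev, inv_inv, mul_inv_mul_self]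

/-- Two compatible elements agree below the idempotents of both. -/
theorem mul_eq_mul_of_compatible {e a b : M} (ha : e * e⁻¹ ≤ a * a⁻¹) (hb : e * e⁻¹ ≤ b * b⁻¹)
    (hab : a⁻¹ * b ≤ 1) : e * e⁻¹ * a = e * e⁻¹ * b := by
  have key : ∀ a b : M, e * e⁻¹ ≤ a * a⁻¹ → a⁻¹ * b ≤ 1 → e * e⁻¹ * b ≤ e * e⁻¹ * a := by
    intro a b ha hab
    rw [mul_inv_le_mul_inv_iff] at ha
    calc e * e⁻¹ * b = e * e⁻¹ * a * (a⁻¹ * b) := by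
          conv_lhs => rw [← ha]
          simp only [mul_assoc]
      _ ≤ e * e⁻¹ * a * 1 := mul_le_mul'' le_rfl hab
      _ = _ := mul_one _
  refine le_antisymm (key b a hb ?_) (key a b ha hab)
  have := inv_le_inv' hab
  rwa [inv_mul_rev, inv_inv, inv_one'] at this

theorem mul_mul_inv_mul_mul (e a : M) :
    e * e⁻¹ * a * (e * e⁻¹ * a)⁻¹ = e * e⁻¹ * (a * a⁻¹) := by
  rw [inv_mul_rev, inv_mul_rev, inv_inv,
    show e * e⁻¹ * a * (a⁻¹ * (e * e⁻¹)) = e * e⁻¹ * (a * a⁻¹ * (e * e⁻¹)) by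
      simp only [mul_assoc], mul_inv_comm a e, ← mul_assoc, mul_inv_mul_self]

theorem mul_inv_le_congr {e a b : M} (h : e * e⁻¹ * a = e * e⁻¹ * b)
    (ha : e * e⁻¹ ≤ a * a⁻¹) : e * e⁻¹ ≤ b * b⁻¹ := by
  rw [mul_inv_le_mul_inv_iff] at ha ⊢
  rw [← mul_mul_inv_mul_mul, ← h, mul_mul_inv_mul_mul, ha]

theorem mul_inv_mul_mul_inv (a b : M) :
    a * b⁻¹ * b * (a * b⁻¹ * b)⁻¹ = a * b⁻¹ * (a * b⁻¹)⁻¹ := by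
  have h := inv_mul_mul b⁻¹
  rw [inv_inv] at h
  rw [inv_mul_rev (a * b⁻¹) b, ← mul_assoc, mul_assoc a, mul_assoc a, mul_assoc b⁻¹, h]

end InverseMonoid

namespace OneRelInverseMonoid

open FreeGroup (invRev)

variable {X : Type*} (w : GWord X)

theorem ofWord_append (s t : GWord X) : ofWord w (s ++ t) = ofWord w s * ofWord w t := rfl

theorem ofWord_nil : ofWord w [] = 1 := rfl

theorem ofWord_eq_of_rel {s t : GWord X}
    (h : InvRel w (FreeMonoid.ofList s) (FreeMonoid.ofList t)) : ofWord w s = ofWord w t :=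
  (Con.eq _).2 (ConGen.Rel.of _ _ h)

theorem ofWord_regular (s : GWord X) :
    ofWord w s * ofWord w (invRev s) * ofWord w s = ofWord w s :=
  (ofWord_eq_of_rel w (InvRel.regular s)).symm

theorem ofWord_comm (s t : GWord X) : ofWord w s * ofWord w (invRev s) *
    (ofWord w t * ofWord w (invRev t)) =
      ofWord w t * ofWord w (invRev t) * (ofWord w s * ofWord w (invRev s)) := by
  have := ofWord_eq_of_rel w (InvRel.idem_comm s t)
  simpa only [ofWord_append, mul_assoc] using this

theorem ofWord_relator : ofWord w w = 1 := ofWord_eq_of_rel w InvRel.relator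

theorem ofWord_invRev_relator : ofWord w (invRev w) = 1 := by
  have := ofWord_regular w w
  rwa [ofWord_relator, one_mul, mul_one] at this

/-- Formal inversion of words respects the defining congruence, so that it induces the inversion
of the monoid. -/
theorem ofWord_invRev_eq {a b : FreeMonoid (X × Bool)} (h : conGen (InvRel w) a b) :
    ofWord w (invRev a.toList) = ofWord w (invRev b.toList) := by
  induction h with
  | of a b h =>
    cases h with
    | regular s =>
      simp only [FreeMonoid.toList_ofList, FreeGroup.invRev_append, FreeGroup.invRev_invRev,
        ofWord_append]
      have := ofWord_regular w (invRev s)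
      rw [FreeGroup.invRev_invRev] at this
      rw [← mul_assoc, this]
    | idem_comm s t =>
      simp only [FreeMonoid.toList_ofList, FreeGroup.invRev_append, FreeGroup.invRev_invRev,
        ofWord_append]
      simpa only [mul_assoc] using ofWord_comm w t s
    | relator => exact ofWord_invRev_relator w
  | refl => rfl
  | symm _ ih => exact ih.symm
  | trans _ _ h1 h2 => exact h1.trans h2
  | mul _ _ h1 h2 =>
    rw [FreeMonoid.toList_mul, FreeMonoid.toList_mul, FreeGroup.invRev_append,
      FreeGroup.invRev_append, ofWord_append, ofWord_append, h1, h2]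

theorem exists_ofWord_eq (x : OneRelInverseMonoid w) : ∃ s, ofWord w s = x := by
  induction x using Con.induction_on with
  | H s => exact ⟨s.toList, rfl⟩

instance : Inv (OneRelInverseMonoid w) :=
  ⟨fun x => Con.liftOn x (fun a => ofWord w (invRev a.toList)) fun _ _ => ofWord_invRev_eq w⟩

theorem ofWord_invRev (s : GWord X) : ofWord w (invRev s) = (ofWord w s)⁻¹ := rfl

instance : InverseMonoid (OneRelInverseMonoid w) where
  inv_inv x := by
    obtain ⟨s, rfl⟩ := exists_ofWord_eq w x
    rw [← ofWord_invRev, ← ofWord_invRev, FreeGroup.invRev_invRev]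
  mul_inv_rev' x y := by
    obtain ⟨s, rfl⟩ := exists_ofWord_eq w x
    obtain ⟨t, rfl⟩ := exists_ofWord_eq w y
    rw [← ofWord_append, ← ofWord_invRev, FreeGroup.invRev_append]
    rfl
  mul_inv_mul' x := by
    obtain ⟨s, rfl⟩ := exists_ofWord_eq w x
    exact ofWord_regular w s
  mul_inv_comm' x y := by
    obtain ⟨s, rfl⟩ := exists_ofWord_eq w x
    obtain ⟨t, rfl⟩ := exists_ofWord_eq w y
    exact ofWord_comm w s t

/-- Free reduction goes up in the natural order. -/
theorem ofWord_le_of_red {s t : GWord X} (h : FreeGroup.Red s t) : ofWord w s ≤ ofWord w t := by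
  induction h with
  | refl => exact le_rfl
  | tail _ hst ih =>
    refine ih.trans ?_
    cases hst with | @not L₁ L₂ x b =>
    rw [ofWord_append, ofWord_append,
      show (x, b) :: (x, !b) :: L₂ = ([(x, b)] ++ invRev [(x, b)]) ++ L₂ from rfl, ofWord_append,
      ofWord_append, ofWord_invRev]
    have := InverseMonoid.mul_le_mul'' (le_refl (ofWord w L₁))
      (InverseMonoid.mul_le_mul'' (InverseMonoid.mul_inv_le_one (ofWord w [(x, b)]))
        (le_refl (ofWord w L₂)))
    rwa [one_mul] at this

end OneRelInverseMonoid

/-! ### The pinched inverse monoid is E-unitary -/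

namespace InverseMonoid

variable {M : Type*} [InverseMonoid M]

theorem inv_pow' (a : M) (n : ℕ) : (a ^ n)⁻¹ = a⁻¹ ^ n := by
  induction n with
  | zero => rw [pow_zero, pow_zero, inv_one']
  | succ n ih => rw [pow_succ, pow_succ', inv_mul_rev, ih]

/-- The power with an integer exponent. It is not additive in the exponent, as `a * a⁻¹` need
not be `1`. -/
def intPow (a : M) (k : ℤ) : M := a ^ k.toNat * a⁻¹ ^ (-k).toNat

@[simp] theorem intPow_zero (a : M) : intPow a 0 = 1 := by simp [intPow]

theorem inv_intPow_neg (a : M) (k : ℤ) : (intPow a (-k))⁻¹ = intPow a k := by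
  rw [intPow, intPow, inv_mul_rev, inv_pow', inv_pow', inv_inv, neg_neg]

theorem intPow_mul_inv {a : M} (ha : a * a⁻¹ = 1) {k : ℤ} (hk : 0 ≤ k) :
    intPow a k * (intPow a k)⁻¹ = 1 := by
  obtain ⟨n, rfl⟩ := Int.eq_ofNat_of_zero_le hk
  have : ∀ n : ℕ, a ^ n * (a ^ n)⁻¹ = 1 := fun n => by
    induction n with
    | zero => rw [pow_zero, inv_one', one_mul]
    | succ n ih => rw [pow_succ]; exact mul_mul_inv_eq_one ih ha
  simpa [intPow] using this n

theorem eq_of_mul_inv_eq_one {a b : M} (h : a * b⁻¹ = 1) : a = b := by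
  have h' : b * a⁻¹ = 1 := by rw [← inv_inv b, ← inv_mul_rev, h, inv_one']
  refine le_antisymm ?_ ?_
  · rw [le_iff_exists_right]
    exact ⟨a⁻¹, by rw [inv_inv, ← mul_assoc, h', one_mul]⟩
  · rw [le_iff_exists_right]
    exact ⟨b⁻¹, by rw [inv_inv, ← mul_assoc, h, one_mul]⟩

end InverseMonoid

namespace PinchedPresentation

open FreeGroup (mul_mk inv_mk invRev zpowWord mk_zpowWord)
open OneRelGroup (ofWord_append)
open InverseMonoid

variable {X Y : Type*} (u : GWord X) (v : GWord Y)

/-- The element of `Inv⟨X ∪ Y | u v⁻¹ = 1⟩` that a word represents. -/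
local notation "μ" => OneRelInverseMonoid.ofWord (pinchedRelator u v)

/-- The two sides of the relation are equal in the inverse monoid, as `a * b⁻¹ = 1` implies
`a = b` in it. -/
theorem inverse_side_eq (b : Bool) : μ (side u v b) = μ (side u v true) := by
  have h : μ (side u v true) * (μ (side u v false))⁻¹ = 1 :=
    OneRelInverseMonoid.ofWord_relator (pinchedRelator u v)
  cases b
  · exact (eq_of_mul_inv_eq_one h).symm
  · rfl

theorem inverse_side_mul_inv : μ (side u v true) * (μ (side u v true))⁻¹ = 1 := by
  have h : μ (side u v true) * (μ (side u v false))⁻¹ = 1 :=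
    OneRelInverseMonoid.ofWord_relator (pinchedRelator u v)
  rwa [inverse_side_eq u v false] at h

theorem inverse_flatten_replicate (s : GWord (X ⊕ Y)) (n : ℕ) :
    μ (List.replicate n s).flatten = μ s ^ n := by
  induction n with
  | zero => rfl
  | succ n ih => rw [List.replicate_succ, List.flatten_cons, OneRelInverseMonoid.ofWord_append, ih,
      pow_succ']

/-- The word that is the `k`-th power of the side `b` of the relation, without reduction. -/
def edgeWord (b : Bool) (k : ℤ) : GWord (X ⊕ Y) := zpowWord (side u v b) (k.toNat, (-k).toNat)

theorem mk_edgeWord (b : Bool) (k : ℤ) :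
    FreeGroup.mk (edgeWord u v b k) = FreeGroup.mk (side u v b) ^ k := by
  rw [edgeWord, mk_zpowWord]
  congr 1
  dsimp only
  omega

theorem inverse_edgeWord (b : Bool) (k : ℤ) :
    μ (edgeWord u v b k) = intPow (μ (side u v true)) k := by
  rw [edgeWord, zpowWord, OneRelInverseMonoid.ofWord_append, inverse_flatten_replicate,
    inverse_flatten_replicate, OneRelInverseMonoid.ofWord_invRev, inverse_side_eq]
  rfl

/-- A word that is equal in the free group to a power of a side of the relation lies below that
power in the inverse monoid. Both lie below the reduced form of that power; for nonnegative
exponents the power is a right unit and hence equal to it, and negative exponents follow by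
inversion. -/
theorem inverse_le_intPow {b : Bool} {g : GWord (X ⊕ Y)} {k : ℤ}
    (h : FreeGroup.mk g = FreeGroup.mk (side u v b) ^ k) :
    μ g ≤ intPow (μ (side u v true)) k := by
  classical
  have key : ∀ (g : GWord (X ⊕ Y)) (k : ℤ), 0 ≤ k →
      FreeGroup.mk g = FreeGroup.mk (side u v b) ^ k →
      μ g ≤ intPow (μ (side u v true)) k := by
    intro g k hk h
    rw [← mk_edgeWord] at h
    have h1 := OneRelInverseMonoid.ofWord_le_of_red (pinchedRelator u v)
      (FreeGroup.reduce.red (L := g))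
    have h2 := OneRelInverseMonoid.ofWord_le_of_red (pinchedRelator u v)
      (FreeGroup.reduce.red (L := edgeWord u v b k))
    rw [FreeGroup.reduce.sound h] at h1
    rw [inverse_edgeWord] at h2
    -- a right unit is maximal in the natural order
    rwa [← eq_of_le_of_mul_inv_eq_one h2 (intPow_mul_inv (inverse_side_mul_inv u v) hk)] at h1
  rcases le_total 0 k with hk | hk
  · exact key g k hk h
  · have h1 := inv_le_inv' (key (invRev g) (-k) (by omega) (by rw [← inv_mk, h, zpow_neg]))
    rwa [inv_intPow_neg, OneRelInverseMonoid.ofWord_invRev, inv_inv] at h1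

/-- The sequence of group elements represented by a sequence of words. -/
def syllableElems (l : List (Bool × GWord (X ⊕ Y))) : List (Bool × FreeGroup (X ⊕ Y)) :=
  l.map fun x => (x.1, FreeGroup.mk x.2)

variable {u v} (hu : u ≠ []) (hv : v ≠ []) (hur : FreeGroup.IsReduced u)
  (hvr : FreeGroup.IsReduced v)

/-- The computation of a normal form of a word in the amalgam goes up in the natural order when it
is carried out in the inverse monoid. -/
theorem exists_le_normalForm (s : GWord (X ⊕ Y)) : ∃ (k : ℤ) (l : List (Bool × GWord (X ⊕ Y))),
    IsReducedSeq (amalgam u v hu hv hur hvr).H (amalgam u v hu hv hur hvr).c (syllableElems l) ∧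
    μ s ≤ intPow (μ (side u v true)) k * (l.map fun x => μ x.2).prod ∧
    OneRelGroup.ofWord (pinchedRelator u v) s = (amalgam u v hu hv hur hvr).t ^ k *
      (amalgam u v hu hv hur hvr).val (syllableElems l) := by
  set A := amalgam u v hu hv hur hvr
  have hφ : ∀ s, OneRelGroup.ofWord (pinchedRelator u v) s = A.φ (FreeGroup.mk s) := fun _ => rfl
  have hte : ∀ b k, A.t ^ k = A.φ (FreeGroup.mk (edgeWord u v b k)) := fun b k => by
    rw [mk_edgeWord]; exact (A.map_zpow_c b k).symm
  have push : ∀ (b : Bool) (g : GWord (X ⊕ Y)) (m : List (Bool × GWord (X ⊕ Y))),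
      FreeGroup.mk g ∈ A.H b → IsReducedSeq A.H A.c (syllableElems m) →
      (∀ x ∈ (syllableElems m).head?, b ≠ x.1) →
      ∃ (k : ℤ) (l : List (Bool × GWord (X ⊕ Y))), IsReducedSeq A.H A.c (syllableElems l) ∧
        μ g * (m.map fun x => μ x.2).prod ≤
          intPow (μ (side u v true)) k * (l.map fun x => μ x.2).prod ∧
        A.φ (FreeGroup.mk g) * A.val (syllableElems m) = A.t ^ k * A.val (syllableElems l) := by
    intro b g m hg hm hmb
    by_cases hgc : FreeGroup.mk g ∈ Subgroup.zpowers (A.c b)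
    · obtain ⟨i, hi⟩ := hgc
      refine ⟨i, m, hm, mul_le_mul'' (inverse_le_intPow u v hi.symm) le_rfl, ?_⟩
      rw [← hi]
      simp only [CyclicAmalgam.map_zpow_c]
    · exact ⟨0, (b, g) :: m, hm.cons hmb hg hgc, by simp, by simp [syllableElems]⟩
  have hH : ∀ x : (X ⊕ Y) × Bool, FreeGroup.mk [x] ∈ A.H x.1.isLeft := fun x =>
    mk_mem_factor (b := x.1.isLeft) (by simp)
  have hcH : ∀ b k, FreeGroup.mk (edgeWord u v b k) ∈ A.H b := fun b k => by
    rw [mk_edgeWord]; exact zpow_mem (A.c_mem b) k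
  induction s with
  | nil => exact ⟨0, [], .nil, by simp [OneRelInverseMonoid.ofWord_nil], by
      simp [syllableElems]; rfl⟩
  | cons x s ih =>
    obtain ⟨k, l, hl, h1, h2⟩ := ih
    have h1' := mul_le_mul'' (le_refl (μ [x])) h1
    rw [← inverse_edgeWord u v x.1.isLeft] at h1'
    rw [← List.singleton_append, OneRelInverseMonoid.ofWord_append, ofWord_append, h2, hφ,
      hte x.1.isLeft]
    by_cases hlb : ∀ y ∈ (syllableElems l).head?, x.1.isLeft ≠ y.1
    · obtain ⟨k', l', h3, h4, h5⟩ := push x.1.isLeft ([x] ++ edgeWord u v x.1.isLeft k) l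
        (by rw [← mul_mk]; exact mul_mem (hH x) (hcH _ k)) hl hlb
      refine ⟨k', l', h3, h1'.trans ?_, ?_⟩
      · rwa [OneRelInverseMonoid.ofWord_append, mul_assoc] at h4
      · rw [← h5, ← mul_mk, map_mul, mul_assoc]
    · obtain ⟨g, m, rfl⟩ : ∃ g m, l = (x.1.isLeft, g) :: m := by
        cases l with
        | nil => simp [syllableElems] at hlb
        | cons y m =>
          refine ⟨y.2, m, ?_⟩
          simp only [syllableElems, List.map_cons, List.head?_cons, Option.mem_def,
            Option.some.injEq, forall_eq', ne_eq, not_not] at hlb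
          rw [hlb]
      obtain ⟨hm, hmh, hgH, -⟩ := IsReducedSeq.cons_iff.1 hl
      obtain ⟨k', l', h3, h4, h5⟩ := push x.1.isLeft ([x] ++ edgeWord u v x.1.isLeft k ++ g) m
        (by rw [← mul_mk, ← mul_mk]; exact mul_mem (mul_mem (hH x) (hcH _ k)) hgH) hm hmh
      refine ⟨k', l', h3, h1'.trans ?_, ?_⟩
      · simpa only [OneRelInverseMonoid.ofWord_append, mul_assoc, List.map_cons,
          List.prod_cons] using h4
      · rw [← h5]
        simp only [syllableElems, List.map_cons, CyclicAmalgam.val_cons, ← mul_mk, map_mul,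
          mul_assoc]

include hu hv hur hvr in
/-- The inverse monoid is E-unitary: the normal form of a word that represents `1` in the group is
trivial, and the word lies below it. -/
theorem inverse_le_one {s : GWord (X ⊕ Y)}
    (hs : OneRelGroup.ofWord (pinchedRelator u v) s = 1) : μ s ≤ 1 := by
  obtain ⟨k, l, hl, h1, h2⟩ := exists_le_normalForm hu hv hur hvr s
  rw [hs] at h2
  have h3 := (amalgam u v hu hv hur hvr).eq_nil_of_val_eq hl (k := -k)
    (by rw [zpow_neg]; exact (inv_eq_of_mul_eq_one_right h2.symm).symm)
  rw [h3, CyclicAmalgam.val_nil, mul_one] at h2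
  have h4 := (amalgam u v hu hv hur hvr).zpow_ne_one k h2.symm
  have h5 : l = [] := by simpa [syllableElems] using h3
  simpa [h4, h5] using h1

end PinchedPresentation

/-! ### Schützenberger graphs -/

namespace OneRelGroup

open FreeGroup (invRev)

variable {X : Type*} (w : GWord X)

/-- The inverse of a letter. -/
def flip (x : X × Bool) : X × Bool := (x.1, !x.2)

theorem flip_flip (x : X × Bool) : flip (flip x) = x := by simp [flip]

theorem ofWord_flip (x : X × Bool) : ofWord w [flip x] = (ofWord w [x])⁻¹ := ofWord_invRev w [x]

/-- Geometric edges of the Cayley graph: the edge with the letter `y` that starts at `1` is, up to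
orientation, the edge with the letter `x` that starts at `g`. -/
def Edge (y : X × Bool) (g : OneRelGroup w) (x : X × Bool) : Prop :=
  (y = x ∧ g = 1) ∨ (y = flip x ∧ g = ofWord w [y])

theorem edge_flip {y : X × Bool} {g : OneRelGroup w} {x : X × Bool} :
    Edge w (flip y) g x ↔ Edge w y (ofWord w [y] * g) x := by
  have h1 : flip y = x ↔ y = flip x :=
    ⟨fun h => by rw [← h, flip_flip], fun h => by rw [h, flip_flip]⟩
  have h2 : flip y = flip x ↔ y = x :=
    ⟨fun h => by rw [← flip_flip y, h, flip_flip], fun h => by rw [h]⟩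
  rw [Edge, Edge, h1, h2, ofWord_flip, mul_eq_left, mul_eq_one_iff_eq_inv', or_comm]

/-- The subgraph of the Cayley graph of the group that consists of the path from `1` with the given
label and of the translates of the subgraph `B` to all vertices of the path. A subgraph is
given by its edges: the value at `g` and `x` says whether the edge that starts at `g` and has the
letter `x` belongs to it, up to orientation. -/
def Trail (B : OneRelGroup w → X × Bool → Prop) :
    GWord X → OneRelGroup w → X × Bool → Prop
  | [] => B
  | y :: t => fun g x => B g x ∨ Edge w y g x ∨ Trail B t ((ofWord w [y])⁻¹ * g) x

variable {w} {B : OneRelGroup w → X × Bool → Prop}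

theorem trail_cons {y : X × Bool} {t : GWord X} {g : OneRelGroup w} {x : X × Bool} :
    Trail w B (y :: t) g x ↔
      B g x ∨ Edge w y g x ∨ Trail w B t ((ofWord w [y])⁻¹ * g) x := Iff.rfl

theorem Trail.base {t : GWord X} {g : OneRelGroup w} {x : X × Bool} (h : B g x) :
    Trail w B t g x := by
  cases t
  exacts [h, Or.inl h]

theorem trail_append {s t : GWord X} {g : OneRelGroup w} {x : X × Bool} :
    Trail w B (s ++ t) g x ↔ Trail w B s g x ∨ Trail w B t ((ofWord w s)⁻¹ * g) x := by
  induction s generalizing g with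
  | nil =>
    rw [List.nil_append, ofWord_nil, inv_one, one_mul]
    exact ⟨Or.inr, fun h => h.elim Trail.base id⟩
  | cons y s ih =>
    rw [List.cons_append, trail_cons, ih, ← List.singleton_append (l := s), ofWord_append,
      mul_inv_rev, mul_assoc, List.singleton_append, trail_cons]
    tauto

theorem trail_invRev {s : GWord X} {g : OneRelGroup w} {x : X × Bool} :
    Trail w B (invRev s) g x ↔ Trail w B s (ofWord w s * g) x := by
  induction s generalizing g with
  | nil => rw [ofWord_nil, one_mul]; rfl
  | cons y s ih =>
    have h : Trail w B (invRev [y]) (ofWord w s * g) x ↔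
        Trail w B [y] (ofWord w [y] * (ofWord w s * g)) x := by
      change (B _ x ∨ Edge w (flip y) _ x ∨ B ((ofWord w [flip y])⁻¹ * _) x) ↔
        (B _ x ∨ Edge w y _ x ∨ B _ x)
      rw [edge_flip, ofWord_flip, inv_inv, inv_mul_cancel_left]
      tauto
    rw [FreeGroup.invRev_cons, trail_append, ih, ofWord_invRev, inv_inv, h,
      ← List.singleton_append (l := s), trail_append, ofWord_append, mul_assoc,
      inv_mul_cancel_left, or_comm]

theorem trail_iff {t : GWord X} {g : OneRelGroup w} {x : X × Bool} :
    Trail w B t g x ↔ Trail w (fun _ _ => False) t g x ∨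
      ∃ p, p <+: t ∧ B ((ofWord w p)⁻¹ * g) x := by
  induction t generalizing g with
  | nil => simp [Trail, ofWord_nil]
  | cons y t ih =>
    rw [trail_cons, ih, trail_cons]
    simp only [List.prefix_cons_iff, or_and_right, exists_or, exists_eq_left, ofWord_nil, inv_one,
      one_mul, false_or]
    have h : (∃ p, (∃ q, p = y :: q ∧ q <+: t) ∧ B ((ofWord w p)⁻¹ * g) x) ↔
        ∃ q, q <+: t ∧ B ((ofWord w q)⁻¹ * ((ofWord w [y])⁻¹ * g)) x := by
      constructor
      · rintro ⟨_, ⟨q, rfl, hq⟩, h⟩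
        refine ⟨q, hq, ?_⟩
        rwa [← List.singleton_append, ofWord_append, mul_inv_rev, mul_assoc] at h
      · rintro ⟨q, hq, h⟩
        refine ⟨_, ⟨q, rfl, hq⟩, ?_⟩
        rwa [← List.singleton_append, ofWord_append, mul_inv_rev, mul_assoc]
    rw [h]
    tauto

theorem trail_false_iff {t : GWord X} {g : OneRelGroup w} {x : X × Bool} :
    Trail w (fun _ _ => False) t g x ↔
      ∃ j < t.length, ∃ y ∈ t[j]?, Edge w y ((ofWord w (t.take j))⁻¹ * g) x := by
  induction t generalizing g with
  | nil => simp [Trail]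
  | cons y t ih =>
    rw [trail_cons, ih, false_or]
    constructor
    · rintro (h | ⟨j, hj, z, hz, h⟩)
      · exact ⟨0, by simp, y, by simp, by simpa [ofWord_nil] using h⟩
      · refine ⟨j + 1, by simpa using hj, z, by simpa using hz, ?_⟩
        rwa [List.take_succ_cons, ← List.singleton_append, ofWord_append, mul_inv_rev, mul_assoc]
    · rintro ⟨_ | j, hj, z, hz, h⟩
      · left
        simp only [List.getElem?_cons_zero, Option.mem_def, Option.some.injEq] at hz
        subst hz
        simpa [ofWord_nil] using h
      · refine Or.inr ⟨j, by simpa using hj, z, by simpa using hz, ?_⟩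
        rwa [List.take_succ_cons, ← List.singleton_append, ofWord_append, mul_inv_rev,
          mul_assoc] at h

variable (w)

/-- The union of the translates of the closed path labelled by the relator to all elements of the
prefix monoid: the Schützenberger graph of the identity. -/
def UnitGraph (g : OneRelGroup w) (x : X × Bool) : Prop :=
  ∃ m ∈ prefixMonoid w, Trail w (fun _ _ => False) w (m⁻¹ * g) x

/-- The Schützenberger graph of a word, as a subgraph of the Cayley graph: the path labelled by the
word, with a copy of the Schützenberger graph of the identity at each vertex. -/
abbrev SchutzenbergerGraph : GWord X → OneRelGroup w → X × Bool → Prop := Trail w (UnitGraph w)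

/-- The path labelled by the relator adds nothing, since its vertices are elements of the prefix
monoid. -/
theorem graph_relator {g : OneRelGroup w} {x : X × Bool} :
    SchutzenbergerGraph w w g x ↔ UnitGraph w g x := by
  refine ⟨fun h => ?_, Trail.base⟩
  rcases trail_iff.1 h with h | ⟨p, hp, m, hm, h⟩
  · exact ⟨1, one_mem _, by rwa [inv_one, one_mul]⟩
  · exact ⟨_, mul_mem (Submonoid.subset_closure ⟨p, hp, rfl⟩) hm, by
      rwa [mul_inv_rev, mul_assoc]⟩

/-- The congruence of having the same value in the group and the same Schützenberger graph. -/
def graphCon : Con (FreeMonoid (X × Bool)) where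
  r s t := ofWord w s.toList = ofWord w t.toList ∧
    SchutzenbergerGraph w s.toList = SchutzenbergerGraph w t.toList
  iseqv := ⟨fun _ => ⟨rfl, rfl⟩, fun h => ⟨h.1.symm, h.2.symm⟩,
    fun h h' => ⟨h.1.trans h'.1, h.2.trans h'.2⟩⟩
  mul' {a b c d} h h' := by
    refine ⟨?_, ?_⟩
    · rw [FreeMonoid.toList_mul, FreeMonoid.toList_mul, ofWord_append, ofWord_append, h.1, h'.1]
    · ext g x
      have h1 : Trail w (UnitGraph w) a.toList = Trail w (UnitGraph w) b.toList := h.2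
      have h2 : Trail w (UnitGraph w) c.toList = Trail w (UnitGraph w) d.toList := h'.2
      rw [FreeMonoid.toList_mul, FreeMonoid.toList_mul]
      exact trail_append.trans (by rw [h1, h2, h.1]; exact trail_append.symm)

theorem conGen_le_graphCon : conGen (InvRel w) ≤ graphCon w := by
  rw [Con.conGen_le]
  intro a b h
  cases h with
  | regular s =>
    refine ⟨?_, ?_⟩
    · simp [ofWord_append, ofWord_invRev]
    · ext g x
      simp only [FreeMonoid.toList_ofList, trail_append, trail_invRev, ofWord_append,
        ofWord_invRev, mul_inv_cancel, inv_one, one_mul, mul_inv_cancel_left]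
      tauto
  | idem_comm s t =>
    refine ⟨?_, ?_⟩
    · simp [ofWord_append, ofWord_invRev]
    · ext g x
      simp only [FreeMonoid.toList_ofList, trail_append, trail_invRev, ofWord_append,
        ofWord_invRev, mul_inv_cancel, inv_one, one_mul, mul_inv_cancel_left]
      tauto
  | relator =>
    refine ⟨ofWord_self w, ?_⟩
    ext g x
    exact graph_relator w

theorem graph_eq_of_inverse_eq {s t : GWord X}
    (h : OneRelInverseMonoid.ofWord w s = OneRelInverseMonoid.ofWord w t) :
    ofWord w s = ofWord w t ∧ SchutzenbergerGraph w s = SchutzenbergerGraph w t :=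
  conGen_le_graphCon w ((Con.eq _).1 h)

/-- The path labelled by `s` runs inside the Schützenberger graph of `t`. -/
def PathSubset (s t : GWord X) : Prop :=
  ∀ i < s.length, ∃ y ∈ s[i]?, SchutzenbergerGraph w t (ofWord w (s.take i)) y

theorem pathSubset_self (s : GWord X) : PathSubset w s s := by
  intro i hi
  refine ⟨s[i], by simp, trail_iff.2 (Or.inl (trail_false_iff.2 ⟨i, hi, s[i], by simp, ?_⟩))⟩
  exact Or.inl ⟨rfl, inv_mul_cancel _⟩

end OneRelGroup

namespace OneRelInverseMonoid

open FreeGroup (invRev)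
open OneRelGroup InverseMonoid

variable {X : Type*} (w : GWord X)

theorem mul_inv_of_prefix {p : GWord X} (hp : p <+: w) : ofWord w p * (ofWord w p)⁻¹ = 1 := by
  obtain ⟨r, hr⟩ := hp
  refine mul_inv_eq_one_of_mul (b := ofWord w r) ?_
  rw [← ofWord_append, hr, ofWord_relator, inv_one', one_mul]

/-- The elements of the prefix monoid lift to right units. -/
theorem exists_rightUnit {m : OneRelGroup w} (hm : m ∈ prefixMonoid w) :
    ∃ z, OneRelGroup.ofWord w z = m ∧ ofWord w z * (ofWord w z)⁻¹ = 1 := by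
  induction hm using Submonoid.closure_induction with
  | mem m hm =>
    obtain ⟨p, hp, rfl⟩ := hm
    exact ⟨p, rfl, mul_inv_of_prefix w hp⟩
  | one => exact ⟨[], rfl, by rw [ofWord_nil, inv_one', one_mul]⟩
  | mul _ _ _ _ h1 h2 =>
    obtain ⟨z, rfl, hz⟩ := h1
    obtain ⟨z', rfl, hz'⟩ := h2
    exact ⟨z ++ z', OneRelGroup.ofWord_append w z z', by
      rw [ofWord_append]; exact mul_mul_inv_eq_one hz hz'⟩

theorem mul_inv_le_of_prefix {p t : GWord X} (hp : p <+: t) :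
    ofWord w t * (ofWord w t)⁻¹ ≤ ofWord w p * (ofWord w p)⁻¹ := by
  obtain ⟨r, rfl⟩ := hp
  rw [ofWord_append]
  exact mul_inv_mul_le _ _

variable {w}

/-- If the path from the vertex `z₀` with label `t` can be traced below the idempotent of `e`, then
each of its edges can, in either direction, after a path from `1` to its start. -/
theorem exists_traced_edge {e : OneRelInverseMonoid w} {z₀ t : GWord X} {g : OneRelGroup w}
    {x : X × Bool} (he : e * e⁻¹ ≤ ofWord w (z₀ ++ t) * (ofWord w (z₀ ++ t))⁻¹)
    (hx : Trail w (fun _ _ => False) t ((OneRelGroup.ofWord w z₀)⁻¹ * g) x) :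
    ∃ z, OneRelGroup.ofWord w z = g ∧
      e * e⁻¹ ≤ ofWord w (z ++ [x]) * (ofWord w (z ++ [x]))⁻¹ := by
  obtain ⟨j, hj, y, hy, h⟩ := trail_false_iff.1 hx
  have hpre : z₀ ++ (t.take j ++ [y]) <+: z₀ ++ t := by
    obtain rfl : t[j] = y := by simpa [hj] using hy
    rw [List.prefix_append_right_inj, List.take_concat_get']
    exact List.take_prefix _ _
  have he' := he.trans (mul_inv_le_of_prefix w hpre)
  rcases h with ⟨rfl, h⟩ | ⟨rfl, h⟩
  · refine ⟨z₀ ++ t.take j, ?_, by rwa [List.append_assoc]⟩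
    rw [OneRelGroup.ofWord_append]
    rw [inv_mul_eq_one, eq_inv_mul_iff_mul_eq] at h
    exact h
  · refine ⟨z₀ ++ (t.take j ++ [OneRelGroup.flip x]), ?_, ?_⟩
    · rw [OneRelGroup.ofWord_append, OneRelGroup.ofWord_append, ← h]
      group
    · have hf : ofWord w [OneRelGroup.flip x] = (ofWord w [x])⁻¹ := ofWord_invRev w [x]
      rw [← List.append_assoc z₀, ofWord_append, hf] at he'
      rwa [ofWord_append, ← List.append_assoc z₀, ofWord_append, hf, mul_inv_mul_mul_inv]

/-- If the path labelled by `s` runs inside the Schützenberger graph of `t`, then it can be traced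
below the idempotent of `t` letter by letter: each of its edges is reached along some path in the
graph, and this path may be exchanged for the initial part of `s`, because paths with the same
endpoints are compatible in an E-unitary inverse monoid. -/
theorem le_of_pathSubset (hE : ∀ s, OneRelGroup.ofWord w s = 1 → ofWord w s ≤ 1) {s t : GWord X}
    (hst : OneRelGroup.ofWord w s = OneRelGroup.ofWord w t) (h : PathSubset w s t) :
    ofWord w t ≤ ofWord w s := by
  have hcomp : ∀ a b : GWord X, OneRelGroup.ofWord w a = OneRelGroup.ofWord w b →
      (ofWord w a)⁻¹ * ofWord w b ≤ 1 := fun a b hab => by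
    rw [← ofWord_invRev, ← ofWord_append]
    refine hE _ ?_
    rw [OneRelGroup.ofWord_append, OneRelGroup.ofWord_invRev, hab, inv_mul_cancel]
  set e := ofWord w t with he
  have key : ∀ i ≤ s.length, e * e⁻¹ ≤ ofWord w (s.take i) * (ofWord w (s.take i))⁻¹ := by
    intro i
    induction i with
    | zero =>
      intro _
      rw [List.take_zero, ofWord_nil, inv_one', one_mul]
      exact mul_inv_le_one e
    | succ i ih =>
      intro hi
      have ih := ih (by omega)
      obtain ⟨y, hy, hΓ⟩ := h i (by omega)
      obtain rfl : s[i] = y := by simpa [show i < s.length by omega] using hy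
      obtain ⟨z, hz, hez⟩ : ∃ z, OneRelGroup.ofWord w z = OneRelGroup.ofWord w (s.take i) ∧
          e * e⁻¹ ≤ ofWord w (z ++ [s[i]]) * (ofWord w (z ++ [s[i]]))⁻¹ := by
        rcases trail_iff.1 hΓ with h1 | ⟨p, hp, m, hm, h1⟩
        · exact exists_traced_edge (z₀ := []) le_rfl
            (by rwa [OneRelGroup.ofWord_nil, inv_one, one_mul])
        · obtain ⟨r, rfl, hr⟩ := exists_rightUnit w hm
          refine exists_traced_edge (z₀ := p ++ r) ?_
            (by rwa [OneRelGroup.ofWord_append, mul_inv_rev, mul_assoc])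
          rw [ofWord_append, ofWord_relator, mul_one, ofWord_append, inv_mul_rev, mul_assoc,
            ← mul_assoc (ofWord w r), hr, one_mul]
          exact mul_inv_le_of_prefix w hp
      have hez' : e * e⁻¹ ≤ ofWord w z * (ofWord w z)⁻¹ := by
        rw [ofWord_append] at hez
        exact hez.trans (mul_inv_mul_le _ _)
      rw [← List.take_concat_get' s i (by omega)]
      refine mul_inv_le_congr ?_ hez
      rw [ofWord_append, ofWord_append, ← mul_assoc, ← mul_assoc,
        mul_eq_mul_of_compatible hez' ih (hcomp _ _ hz)]
  have h1 := key s.length le_rfl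
  rw [List.take_length] at h1
  rw [le_def, ← mul_eq_mul_of_compatible le_rfl h1 (hcomp t s hst.symm), mul_inv_mul]

/-- In the E-unitary case, an element is determined by its value in the group and its
Schützenberger graph; of the latter only the path of one word in the graph of the other has to be
checked. -/
theorem ofWord_eq_iff (hE : ∀ s, OneRelGroup.ofWord w s = 1 → ofWord w s ≤ 1) {s t : GWord X} :
    ofWord w s = ofWord w t ↔ OneRelGroup.ofWord w s = OneRelGroup.ofWord w t ∧
      PathSubset w s t ∧ PathSubset w t s := by
  constructor
  · intro h
    obtain ⟨h1, h2⟩ := graph_eq_of_inverse_eq w h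
    refine ⟨h1, ?_, ?_⟩
    · have := pathSubset_self w s
      rwa [PathSubset, h2] at this
    · have := pathSubset_self w t
      rwa [PathSubset, ← h2] at this
  · rintro ⟨h1, h2, h3⟩
    exact le_antisymm (le_of_pathSubset hE h1.symm h3) (le_of_pathSubset hE h1 h2)

end OneRelInverseMonoid

/-! ### Decidability of the word problem -/

namespace OneRelGroup

open FreeGroup (invRev)

variable {X : Type*} {w : GWord X}

variable (w) in
/-- The edges of the Schützenberger graph of the identity in terms of membership in the prefix
monoid, for the decision procedure. -/
theorem unitGraph_iff {g : OneRelGroup w} {x : X × Bool} : UnitGraph w g x ↔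
    ∃ j < w.length, ∃ y ∈ w[j]?, (y = x ∧ g * (ofWord w (w.take j))⁻¹ ∈ prefixMonoid w) ∨
      (y = flip x ∧ g * (ofWord w (w.take j ++ [y]))⁻¹ ∈ prefixMonoid w) := by
  simp only [UnitGraph, trail_false_iff, Edge]
  constructor
  · rintro ⟨m, hm, j, hj, y, hy, ⟨rfl, h⟩ | ⟨rfl, h⟩⟩
    · refine ⟨j, hj, y, hy, Or.inl ⟨rfl, ?_⟩⟩
      convert hm using 1
      rw [inv_mul_eq_one] at h
      rw [h]
      group
    · refine ⟨j, hj, _, hy, Or.inr ⟨rfl, ?_⟩⟩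
      convert hm using 1
      rw [ofWord_append, ← h]
      group
  · rintro ⟨j, hj, y, hy, ⟨rfl, h⟩ | ⟨rfl, h⟩⟩
    · exact ⟨_, h, j, hj, y, hy, Or.inl ⟨rfl, by group⟩⟩
    · exact ⟨_, h, j, hj, _, hy, Or.inr ⟨rfl, by rw [ofWord_append]; group⟩⟩

variable [Primcodable X]

theorem primrec_flip : Primrec (flip : X × Bool → X × Bool) :=
  Primrec.fst.pair (Primrec.not.comp Primrec.snd)

theorem computablePred_ofWord_eq (hW : ComputablePred fun s => ofWord w s = 1) :
    ComputablePred fun p : GWord X × GWord X => ofWord w p.1 = ofWord w p.2 := by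
  refine (hW.comp (f := fun p : GWord X × GWord X => p.1 ++ invRev p.2)
    (Primrec.list_append.comp Primrec.fst
      (FreeGroup.primrec_invRev.comp Primrec.snd)).to_comp).of_eq fun p => ?_
  rw [ofWord_append, ofWord_invRev, mul_inv_eq_one]

theorem computablePred_unitGraph (hP : DecidablePrefixMembership w) :
    ComputablePred fun p : GWord X × (X × Bool) => UnitGraph w (ofWord w p.1) p.2 := by
  -- A query is a tuple `(((g, x), j), y)`.
  have hg : Primrec fun p : ((GWord X × (X × Bool)) × ℕ) × (X × Bool) => p.1.1.1 :=
    Primrec.fst.comp (Primrec.fst.comp Primrec.fst)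
  have hx : Primrec fun p : ((GWord X × (X × Bool)) × ℕ) × (X × Bool) => p.1.1.2 :=
    Primrec.snd.comp (Primrec.fst.comp Primrec.fst)
  have hj : Primrec fun p : ((GWord X × (X × Bool)) × ℕ) × (X × Bool) => w.take p.1.2 :=
    Primrec.list_take.comp (Primrec.snd.comp Primrec.fst) (Primrec.const w)
  have hy : Primrec fun p : ((GWord X × (X × Bool)) × ℕ) × (X × Bool) => p.2 := Primrec.snd
  have h1 := (Primrec.eq.comp hy hx).computablePred.and
    (hP.comp (Primrec.list_append.comp hg (FreeGroup.primrec_invRev.comp hj)).to_comp)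
  have h2 := (Primrec.eq.comp hy (primrec_flip.comp hx)).computablePred.and
    (hP.comp (Primrec.list_append.comp hg (FreeGroup.primrec_invRev.comp
      (Primrec.list_append.comp hj (Primrec.list_cons.comp hy (Primrec.const []))))).to_comp)
  have h3 := (h1.or h2).exists_mem_option (f := fun p : (GWord X × (X × Bool)) × ℕ => w[p.2]?)
    (Primrec.list_getElem?.comp (Primrec.const w) Primrec.snd).to_comp
  refine (h3.exists_lt (f := fun _ => w.length) (Computable.const _)).of_eq fun p => ?_
  simp only [unitGraph_iff w, ofWord_append, ofWord_invRev]

/-- Edges of a path are decided by tests of equality in the group. -/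
theorem computablePred_trail (hW : ComputablePred fun s => ofWord w s = 1) :
    ComputablePred fun p : GWord X × GWord X × (X × Bool) =>
      Trail w (fun _ _ => False) p.1 (ofWord w p.2.1) p.2.2 := by
  have ht : Primrec fun p : ((GWord X × GWord X × (X × Bool)) × ℕ) × (X × Bool) =>
      p.1.1.1.take p.1.2 :=
    Primrec.list_take.comp (Primrec.snd.comp Primrec.fst)
      (Primrec.fst.comp (Primrec.fst.comp Primrec.fst))
  have hg : Primrec fun p : ((GWord X × GWord X × (X × Bool)) × ℕ) × (X × Bool) => p.1.1.2.1 :=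
    Primrec.fst.comp (Primrec.snd.comp (Primrec.fst.comp Primrec.fst))
  have hx : Primrec fun p : ((GWord X × GWord X × (X × Bool)) × ℕ) × (X × Bool) => p.1.1.2.2 :=
    Primrec.snd.comp (Primrec.snd.comp (Primrec.fst.comp Primrec.fst))
  have hy : Primrec fun p : ((GWord X × GWord X × (X × Bool)) × ℕ) × (X × Bool) => p.2 :=
    Primrec.snd
  have hh := Primrec.list_append.comp (FreeGroup.primrec_invRev.comp ht) hg
  have h1 := (Primrec.eq.comp hy hx).computablePred.and (hW.comp hh.to_comp)
  have h2 := (Primrec.eq.comp hy (primrec_flip.comp hx)).computablePred.and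
    ((computablePred_ofWord_eq hW).comp
      (hh.pair (Primrec.list_cons.comp hy (Primrec.const []))).to_comp)
  have h3 := (h1.or h2).exists_mem_option
    (f := fun p : (GWord X × GWord X × (X × Bool)) × ℕ => p.1.1[p.2]?)
    (Primrec.list_getElem?.comp (Primrec.fst.comp Primrec.fst) Primrec.snd).to_comp
  refine (h3.exists_lt (f := fun p => p.1.length)
    (Primrec.list_length.comp Primrec.fst).to_comp).of_eq fun p => ?_
  simp only [trail_false_iff, Edge, ofWord_append, ofWord_invRev]

theorem computablePred_graph (hW : ComputablePred fun s => ofWord w s = 1)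
    (hP : DecidablePrefixMembership w) :
    ComputablePred fun p : GWord X × GWord X × (X × Bool) =>
      SchutzenbergerGraph w p.1 (ofWord w p.2.1) p.2.2 := by
  have ht : Primrec fun p : (GWord X × GWord X × (X × Bool)) × ℕ => p.1.1.take p.2 :=
    Primrec.list_take.comp Primrec.snd (Primrec.fst.comp Primrec.fst)
  have hg : Primrec fun p : (GWord X × GWord X × (X × Bool)) × ℕ => p.1.2.1 :=
    Primrec.fst.comp (Primrec.snd.comp Primrec.fst)
  have hx : Primrec fun p : (GWord X × GWord X × (X × Bool)) × ℕ => p.1.2.2 :=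
    Primrec.snd.comp (Primrec.snd.comp Primrec.fst)
  have h1 := (computablePred_unitGraph hP).comp
    ((Primrec.list_append.comp (FreeGroup.primrec_invRev.comp ht) hg).pair hx).to_comp
  have h2 := h1.exists_lt (f := fun p => p.1.length + 1)
    (Primrec.succ.comp (Primrec.list_length.comp Primrec.fst)).to_comp
  refine ((computablePred_trail hW).or h2).of_eq fun p => ?_
  refine (or_congr Iff.rfl ?_).trans (trail_iff (B := UnitGraph w)).symm
  simp only [ofWord_append, ofWord_invRev]
  constructor
  · rintro ⟨j, -, h⟩
    exact ⟨_, List.take_prefix _ _, h⟩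
  · rintro ⟨q, hq, h⟩
    exact ⟨q.length, Nat.lt_succ_of_le hq.length_le, by rwa [← List.prefix_iff_eq_take.1 hq]⟩

theorem computablePred_pathSubset (hW : ComputablePred fun s => ofWord w s = 1)
    (hP : DecidablePrefixMembership w) :
    ComputablePred fun p : GWord X × GWord X => PathSubset w p.1 p.2 := by
  have hs : Primrec fun p : ((GWord X × GWord X) × ℕ) × (X × Bool) => p.1.1.1.take p.1.2 :=
    Primrec.list_take.comp (Primrec.snd.comp Primrec.fst)
      (Primrec.fst.comp (Primrec.fst.comp Primrec.fst))
  have ht : Primrec fun p : ((GWord X × GWord X) × ℕ) × (X × Bool) => p.1.1.2 :=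
    Primrec.snd.comp (Primrec.fst.comp Primrec.fst)
  have h1 := (computablePred_graph hW hP).comp (ht.pair (hs.pair Primrec.snd)).to_comp
  have h2 := h1.exists_mem_option (f := fun p : (GWord X × GWord X) × ℕ => p.1.1[p.2]?)
    (Primrec.list_getElem?.comp (Primrec.fst.comp Primrec.fst) Primrec.snd).to_comp
  exact h2.forall_lt (f := fun p => p.1.length) (Primrec.list_length.comp Primrec.fst).to_comp

/-- An E-unitary special one-relator inverse monoid has decidable word problem if the group has
decidable word and prefix membership problems. -/
theorem decidableInverseWordProblem (hW : ComputablePred fun s => ofWord w s = 1)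
    (hP : DecidablePrefixMembership w)
    (hE : ∀ s, ofWord w s = 1 → OneRelInverseMonoid.ofWord w s ≤ 1) :
    DecidableInverseWordProblem w := by
  have h := computablePred_pathSubset hW hP
  refine ((computablePred_ofWord_eq hW).and (h.and (h.comp
    (Primrec.snd.pair Primrec.fst).to_comp))).of_eq fun p => ?_
  exact (OneRelInverseMonoid.ofWord_eq_iff hE).symm

end OneRelGroup

theorem mainTheorem7 {X Y : Type*} [Finite X] [Finite Y] [Primcodable X] [Primcodable Y]
    (u : GWord X) (v : GWord Y) (hu : u ≠ []) (hv : v ≠ [])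
    (hur : FreeGroup.IsReduced u) (hvr : FreeGroup.IsReduced v) :
    DecidablePrefixMembership (pinchedRelator u v) ∧
      DecidableInverseWordProblem (pinchedRelator u v) := by
  have hP := PinchedPresentation.decidablePrefixMembership hu hv hur hvr
  exact ⟨hP, OneRelGroup.decidableInverseWordProblem
    (PinchedPresentation.computablePred_ofWord_eq_one hu hv hur hvr) hP
    fun _ => PinchedPresentation.inverse_le_one hu hv hur hvr⟩
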